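/- **Definitions.** Let $(X,d)$ be a geodesic metric space. Geodesic segments may be degenerate. For $r\ge 0$, a geodesic segment $\gamma$ in $X$ is *$r$-thin* if for every geodesic quadrangle $(\gamma_1,\gamma_2,\gamma_3,\gamma_4)$ in $X$ such that $\gamma$ is a subsegment of $\gamma_1$, the set $\gamma_2\cup\gamma_3\cup\gamma_4$ meets the closed $r$-ball around the midpoint of $\gamma$. A *contraction gauge* is a non-decreasing function $K:[0,\infty)\to[0,\infty]$ with $K(r)\ge 4r+1$ for all $r\geq 0$; it is *full* if it does not take the value $\infty$. A pair $(x,y)\in X\times X$ is *$K$-anti-contracting* if $d(x,y)\ge 1$ and, for all $r\ge 0$ and all geodesics $\gamma$ from $x$ to $y$, no subsegment of $\gamma$ of length at least $K(r)$ is $r$-thin. The *$K$-contraction space* $\hat X_K$, equipped with the induced path metric, is obtained from $X$ by attaching, for every $K$-anti-contracting pair $(x,y)$, an interval of length one with its endpoints glued to $x$ and $y$. For $K(r)=10r+1$ it is denoted $\hat X$ and called the *contraction space*. An isometric action of a group $G$ on $X$ induces an isometric action of $G$ on $\hat X_K$. The action of $G$ on $X$ is *proper* if for every bounded $B\subseteq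 X$ the set $\{g\in G: gB\cap B\neq\emptyset\}$ is finite. An isometric action of $G$ on a metric space $Y$ is *non-uniformly acylindrical* if $Y$ is Gromov hyperbolic (four-point condition) and for every $R>0$ there is $D\ge 0$ such that for all $x,y\in Y$ at distance at least $D$ the set $\{g\in G: d_Y(x,gx)<R,\ d_Y(y,gy)<R\}$ is finite. A bi-infinite *$C$-quasi-geodesic* ($C\ge 1$) is a continuous map $\gamma:\mathbb R\to X$ with $|s-t|/C-C\le d(\gamma(s),\gamma(t))\le C|s-t|+C$ for all $s,t$. It is *$C$-contracting* if for every $x\in X$ the closest point projection to the image of $\gamma$ of the open ball of radius $d(x,\gamma)$ around $x$ has diameter at most $C$. The axis of $g\in G$ in $X$ is *strongly contracting* if $n\mapsto g^n x$ is a quasi-isometric embedding $\mathbb Z\to X$ for some $x\in X$ and, for some $C$, $g$ stabilizes (the image of) a bi-infinite $C$-contracting $C$-quasi-geodesic. **Theorem.** Let $G$ be a group acting properly by isometries on a geodesic metric space $X$, and let $K$ be a full contraction gauge with $K(r)\ge 10r+1$ for all $r\ge 0$. Then the action of $G$ on the $K$-contraction space $\hat X_K$ is non-uniformly acylindrical.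 If moreover some element $g\in G$ has a strongly contracting axis in $X$, then every $G$-orbit in $\hat X_K$ is unbounded. In particular, both statements hold for the contraction space $\hat X$. -/

import Mathlib

open scoped NNReal ENNReal Pointwise

namespace ContractionSpaces

universe u v

/-! ### Geodesics -/

/-- A geodesic segment of length `len` in `X`: an isometric embedding of `[0, len]`.
The values of `toFun` outside `[0, len]` are irrelevant. -/
structure GeodesicSegment (X : Type u) [MetricSpace X] where
  len : ℝ
  toFun : ℝ → X
  len_nonneg : 0 ≤ len
  isom : ∀ s ∈ Set.Icc 0 len, ∀ t ∈ Set.Icc 0 len, dist (toFun s) (toFun t) = |s - t|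

namespace GeodesicSegment

variable {X : Type u} [MetricSpace X]

/-- The initial point. -/
def source (γ : GeodesicSegment X) : X := γ.toFun 0

/-- The terminal point. -/
def target (γ : GeodesicSegment X) : X := γ.toFun γ.len

/-- The midpoint. -/
noncomputable def midpoint (γ : GeodesicSegment X) : X := γ.toFun (γ.len / 2)

/-- The set of points of the segment. -/
def image (γ : GeodesicSegment X) : Set X := γ.toFun '' Set.Icc 0 γ.len

/-- `γ'` is a subsegment of `γ`. -/
def IsSubsegment (γ' γ : GeodesicSegment X) : Prop :=
  ∃ s : ℝ, 0 ≤ s ∧ s + γ'.len ≤ γ.len ∧ ∀ t ∈ Set.Icc 0 γ'.len, γ'.toFun t = γ.toFun (s + t)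

/-- `γ` is `r`-thin: for every geodesic quadrangle `(γ₁, γ₂, γ₃, γ₄)` (possibly degenerate) such
that `γ` is a subsegment of `γ₁`, the union `γ₂ ∪ γ₃ ∪ γ₄` meets the closed `r`-ball around the
midpoint of `γ`. -/
def IsThin (γ : GeodesicSegment X) (r : ℝ) : Prop :=
  ∀ γ₁ γ₂ γ₃ γ₄ : GeodesicSegment X,
    γ₁.target = γ₂.source → γ₂.target = γ₃.source →
    γ₃.target = γ₄.source → γ₄.target = γ₁.source →
    γ.IsSubsegment γ₁ →
    ∃ p ∈ γ₂.image ∪ γ₃.image ∪ γ₄.image, p ∈ Metric.closedBall γ.midpoint r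

/-- The translate of a geodesic segment by an isometry of an acting group. -/
def translate {G : Type v} [Group G] [MulAction G X] [IsIsometricSMul G X]
    (g : G) (γ : GeodesicSegment X) : GeodesicSegment X where
  len := γ.len
  toFun t := g • γ.toFun t
  len_nonneg := γ.len_nonneg
  isom s hs t ht := by rw [dist_smul]; exact γ.isom s hs t ht

end GeodesicSegment

/-- Any two points of `X` are joined by a geodesic segment. -/
def IsGeodesicSpace (X : Type u) [MetricSpace X] : Prop :=
  ∀ x y : X, ∃ γ : GeodesicSegment X, γ.source = x ∧ γ.target = y

/-! ### Contraction gauges and anti-contracting pairs -/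

/-- A contraction gauge: a non-decreasing `K : [0, ∞) → [0, ∞]` with `K r ≥ 4 r + 1`. -/
structure IsContractionGauge (K : ℝ≥0 → ℝ≥0∞) : Prop where
  mono : Monotone K
  le_apply : ∀ r : ℝ≥0, 4 * (r : ℝ≥0∞) + 1 ≤ K r

/-- A contraction gauge is full if it does not take the value `∞`. -/
def IsFullGauge (K : ℝ≥0 → ℝ≥0∞) : Prop :=
  IsContractionGauge K ∧ ∀ r : ℝ≥0, K r ≠ ∞

/-- The gauge `K r = 10 r + 1`, whose contraction space is called *the* contraction space. -/
noncomputable def standardGauge : ℝ≥0 → ℝ≥0∞ := fun r => 10 * (r : ℝ≥0∞) + 1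

theorem isFullGauge_standardGauge : IsFullGauge standardGauge := by
  refine ⟨⟨fun r s h => ?_, fun r => ?_⟩, fun r => ?_⟩
  · simp only [standardGauge]
    gcongr
  · simp only [standardGauge]
    gcongr
    norm_num
  · simp only [standardGauge]
    finiteness

/-- `(x, y)` is `K`-anti-contracting: `d(x, y) ≥ 1` and for all `r ≥ 0`, no geodesic from `x` to
`y` has an `r`-thin subsegment of length at least `K r`. -/
def IsAntiContracting {X : Type u} [MetricSpace X] (K : ℝ≥0 → ℝ≥0∞) (x y : X) : Prop :=
  1 ≤ dist x y ∧
    ∀ (r : ℝ≥0) (γ γ' : GeodesicSegment X), γ.source = x → γ.target = y →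
      γ'.IsSubsegment γ → K r ≤ ENNReal.ofReal γ'.len → ¬ γ'.IsThin r

/-- The set of `K`-anti-contracting pairs. -/
def AntiContractingPair (X : Type u) [MetricSpace X] (K : ℝ≥0 → ℝ≥0∞) : Type u :=
  {p : X × X // IsAntiContracting K p.1 p.2}

theorem GeodesicSegment.IsThin.translate {X : Type u} [MetricSpace X] {G : Type v} [Group G]
    [MulAction G X] [IsIsometricSMul G X] (g : G) {γ : GeodesicSegment X} {r : ℝ}
    (h : γ.IsThin r) : (γ.translate g).IsThin r := by
  intro γ₁ γ₂ γ₃ γ₄ h₁ h₂ h₃ h₄ ⟨s, hs, hl, hsub⟩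
  have key := h (γ₁.translate g⁻¹) (γ₂.translate g⁻¹) (γ₃.translate g⁻¹) (γ₄.translate g⁻¹)
    (congrArg (g⁻¹ • ·) h₁) (congrArg (g⁻¹ • ·) h₂) (congrArg (g⁻¹ • ·) h₃)
    (congrArg (g⁻¹ • ·) h₄)
    ⟨s, hs, hl, fun t ht => by
      have := congrArg (g⁻¹ • ·) (hsub t ht)
      simpa [GeodesicSegment.translate] using this⟩
  obtain ⟨p, hp, hpm⟩ := key
  refine ⟨g • p, ?_, ?_⟩
  · have aux : ∀ δ : GeodesicSegment X, p ∈ (δ.translate g⁻¹).image → g • p ∈ δ.image := by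
      rintro δ ⟨t, ht, rfl⟩
      exact ⟨t, ht, by simp [GeodesicSegment.translate]⟩
    rcases hp with (hp | hp) | hp
    · exact Or.inl (Or.inl (aux _ hp))
    · exact Or.inl (Or.inr (aux _ hp))
    · exact Or.inr (aux _ hp)
  · have : dist (g • p) (g • γ.midpoint) ≤ r := by rw [dist_smul]; exact hpm
    exact this

theorem IsAntiContracting.smul {X : Type u} [MetricSpace X] {K : ℝ≥0 → ℝ≥0∞} {G : Type v}
    [Group G] [MulAction G X] [IsIsometricSMul G X] (g : G) {x y : X}
    (h : IsAntiContracting K x y) : IsAntiContracting K (g • x) (g • y) := by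
  refine ⟨by rw [dist_smul]; exact h.1, ?_⟩
  intro r γ γ' hs ht ⟨s, hs0, hl, hsub⟩ hK hthin
  refine h.2 r (γ.translate g⁻¹) (γ'.translate g⁻¹) ?_ ?_
    ⟨s, hs0, hl, fun t ht => congrArg (g⁻¹ • ·) (hsub t ht)⟩ hK (hthin.translate g⁻¹)
  · exact (congrArg (g⁻¹ • ·) hs).trans (inv_smul_smul g x)
  · exact (congrArg (g⁻¹ • ·) ht).trans (inv_smul_smul g y)

/-! ### The contraction space -/

/-- The points of the `K`-contraction space of `X`: the points of `X`, together with the interior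
points of an interval of length one for every `K`-anti-contracting pair (the endpoints of that
interval are glued to, that is, are, the two points of the pair). -/
inductive ContractionSpace (X : Type u) [MetricSpace X] (K : ℝ≥0 → ℝ≥0∞) : Type u
  | incl (x : X) : ContractionSpace X K
  | inner (p : AntiContractingPair X K) (t : Set.Ioo (0 : ℝ) 1) : ContractionSpace X K

namespace ContractionSpace

variable {X : Type u} [MetricSpace X] {K : ℝ≥0 → ℝ≥0∞}

open Classical in
/-- The interval `[0, 1] → X̂` attached along the pair `p`; it runs from `p.1` to `p.2`. -/
noncomputable def edge (p : AntiContractingPair X K) (t : ℝ) : ContractionSpace X K :=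
  if h : t ∈ Set.Ioo (0 : ℝ) 1 then inner p ⟨t, h⟩
  else if t ≤ 0 then incl p.1.1 else incl p.1.2

/-- `z` and `w` are joined by a geodesic of length `ℓ` of one of the pieces: of `X`, or of one of
the attached unit intervals. -/
inductive IsStep : ContractionSpace X K → ContractionSpace X K → ℝ → Prop
  | base (x y : X) : IsStep (incl x) (incl y) (dist x y)
  | along (p : AntiContractingPair X K) (s t : ℝ) (hs : s ∈ Set.Icc (0 : ℝ) 1)
      (ht : t ∈ Set.Icc (0 : ℝ) 1) : IsStep (edge p s) (edge p t) |s - t|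

/-- `IsPathLength z w ℓ`: some concatenation of finitely many geodesics of the pieces
leads from `z` to `w` and has length `ℓ`. -/
inductive IsPathLength : ContractionSpace X K → ContractionSpace X K → ℝ → Prop
  | nil (z : ContractionSpace X K) : IsPathLength z z 0
  | cons {z w v : ContractionSpace X K} {a b : ℝ} (hzw : IsStep z w a)
      (hwv : IsPathLength w v b) : IsPathLength z v (a + b)

/-- The induced path metric: the infimum of the lengths of the paths from `z` to `w`. -/
noncomputable def pathDist (z w : ContractionSpace X K) : ℝ :=
  sInf {ℓ : ℝ | IsPathLength z w ℓ}

theorem edge_zero (p : AntiContractingPair X K) : edge p 0 = incl p.1.1 := by simp [edge]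

theorem edge_one (p : AntiContractingPair X K) : edge p 1 = incl p.1.2 := by simp [edge]

theorem edge_of_mem (p : AntiContractingPair X K) (t : Set.Ioo (0 : ℝ) 1) :
    edge p t = inner p t := by
  have := t.2
  simp [edge]

theorem IsStep.symm {z w : ContractionSpace X K} {a : ℝ} (h : IsStep z w a) : IsStep w z a := by
  cases h with
  | base x y => rw [dist_comm]; exact .base y x
  | along p s t hs ht => rw [abs_sub_comm]; exact .along p t s ht hs

theorem IsStep.nonneg {z w : ContractionSpace X K} {a : ℝ} (h : IsStep z w a) : 0 ≤ a := by
  cases h with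
  | base x y => exact dist_nonneg
  | along p s t hs ht => exact abs_nonneg _

theorem IsStep.isPathLength {z w : ContractionSpace X K} {a : ℝ} (h : IsStep z w a) :
    IsPathLength z w a := by
  simpa using IsPathLength.cons h (.nil w)

theorem IsPathLength.trans {z w v : ContractionSpace X K} {a b : ℝ} (h : IsPathLength z w a)
    (h' : IsPathLength w v b) : IsPathLength z v (a + b) := by
  induction h with
  | nil z => simpa using h'
  | cons hs _ ih => rw [add_assoc]; exact .cons hs (ih h')

theorem IsPathLength.symm {z w : ContractionSpace X K} {a : ℝ} (h : IsPathLength z w a) :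
    IsPathLength w z a := by
  induction h with
  | nil z => exact .nil z
  | cons hs _ ih => rw [add_comm]; exact ih.trans hs.symm.isPathLength

theorem IsPathLength.nonneg {z w : ContractionSpace X K} {a : ℝ} (h : IsPathLength z w a) :
    0 ≤ a := by
  induction h with
  | nil z => exact le_rfl
  | cons hs _ ih => exact add_nonneg hs.nonneg ih

theorem exists_isPathLength (z w : ContractionSpace X K) : ∃ ℓ, IsPathLength z w ℓ := by
  have toX : ∀ z : ContractionSpace X K, ∃ (x : X) (ℓ : ℝ), IsPathLength z (incl x) ℓ := by
    intro z
    cases z with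
    | incl x => exact ⟨x, 0, .nil _⟩
    | inner p t =>
      refine ⟨p.1.1, |(t : ℝ) - 0|, ?_⟩
      rw [← edge_of_mem, ← edge_zero]
      exact (IsStep.along p t 0 ⟨t.2.1.le, t.2.2.le⟩ (by simp)).isPathLength
  obtain ⟨x, a, ha⟩ := toX z
  obtain ⟨y, b, hb⟩ := toX w
  exact ⟨_, (ha.trans (IsStep.base x y).isPathLength).trans hb.symm⟩

theorem bddBelow_pathLengths (z w : ContractionSpace X K) :
    BddBelow {ℓ : ℝ | IsPathLength z w ℓ} := ⟨0, fun _ h => IsPathLength.nonneg h⟩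

theorem pathDist_self (z : ContractionSpace X K) : pathDist z z = 0 :=
  le_antisymm (csInf_le (bddBelow_pathLengths z z) (.nil z))
    (le_csInf (exists_isPathLength z z) fun _ h => IsPathLength.nonneg h)

theorem pathDist_comm (z w : ContractionSpace X K) : pathDist z w = pathDist w z := by
  unfold pathDist
  congr 1
  ext ℓ
  exact ⟨IsPathLength.symm, IsPathLength.symm⟩

theorem pathDist_triangle (z w v : ContractionSpace X K) :
    pathDist z v ≤ pathDist z w + pathDist w v := by
  refine le_of_forall_pos_le_add fun ε hε => ?_
  obtain ⟨a, ha, ha'⟩ := exists_lt_of_csInf_lt (exists_isPathLength z w)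
    (lt_add_of_pos_right (pathDist z w) (half_pos hε))
  obtain ⟨b, hb, hb'⟩ := exists_lt_of_csInf_lt (exists_isPathLength w v)
    (lt_add_of_pos_right (pathDist w v) (half_pos hε))
  have := csInf_le (bddBelow_pathLengths z v) (IsPathLength.trans ha hb)
  change pathDist z v ≤ a + b at this
  linarith

theorem abs_sub_le_pathDist {f : ContractionSpace X K → ℝ}
    (hf : ∀ z w a, IsStep z w a → |f z - f w| ≤ a) (z w : ContractionSpace X K) :
    |f z - f w| ≤ pathDist z w := by
  refine le_csInf (exists_isPathLength z w) fun ℓ h => ?_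
  change IsPathLength z w ℓ at h
  induction h with
  | nil z => simp
  | cons hs _ ih => exact (abs_sub_le _ _ _).trans (add_le_add (hf _ _ _ hs) ih)

theorem eq_of_pathDist_incl {x : X} {w : ContractionSpace X K}
    (h : pathDist (incl x) w = 0) : incl x = w := by
  let c : X → ℝ := fun y => min (dist x y) 1
  let f : ContractionSpace X K → ℝ := fun z => match z with
    | incl y => c y
    | inner p t => (1 - t) * c p.1.1 + t * c p.1.2
  have hc0 : ∀ y, 0 ≤ c y := fun y => le_min dist_nonneg zero_le_one
  have hc1 : ∀ y, c y ≤ 1 := fun y => min_le_right _ _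
  have hedge : ∀ p : AntiContractingPair X K, ∀ t ∈ Set.Icc (0 : ℝ) 1,
      f (edge p t) = (1 - t) * c p.1.1 + t * c p.1.2 := by
    intro p t ht
    rcases eq_or_lt_of_le ht.1 with h0 | h0
    · rw [← h0, edge_zero]; simp [f]
    rcases eq_or_lt_of_le ht.2 with h1 | h1
    · rw [h1, edge_one]; simp [f]
    exact congrArg f (edge_of_mem p ⟨t, h0, h1⟩)
  have hf : ∀ z w a, IsStep z w a → |f z - f w| ≤ a := by
    intro z w a hs
    cases hs with
    | base y z =>
      change |min (dist x y) 1 - min (dist x z) 1| ≤ _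
      refine (abs_min_sub_min_le_max _ _ _ _).trans ?_
      simp only [sub_self, abs_zero]
      refine max_le ?_ dist_nonneg
      rw [dist_comm x y, dist_comm x z]
      exact abs_dist_sub_le y z x
    | along p s t hs ht =>
      rw [hedge p s hs, hedge p t ht]
      have e : (1 - s) * c p.1.1 + s * c p.1.2 - ((1 - t) * c p.1.1 + t * c p.1.2)
          = (s - t) * (c p.1.2 - c p.1.1) := by ring
      rw [e, abs_mul]
      refine mul_le_of_le_one_right (abs_nonneg _) (abs_le.2 ⟨?_, ?_⟩)
      · linarith [hc0 p.1.2, hc1 p.1.1]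
      · linarith [hc0 p.1.1, hc1 p.1.2]
  have key := abs_sub_le_pathDist hf (incl x) w
  have hx : f (incl x) = 0 := by simp [f, c]
  rw [h, hx, zero_sub, abs_neg] at key
  have hw : f w = 0 := abs_nonpos_iff.1 key
  have hcz : ∀ y, c y = 0 → x = y := by
    intro y hy
    by_contra hne
    exact (lt_min (dist_pos.2 hne) one_pos).ne' hy
  cases w with
  | incl y => rw [hcz y hw]
  | inner p t =>
    exfalso
    change (1 - (t : ℝ)) * c p.1.1 + t * c p.1.2 = 0 at hw
    have ht0 : 0 < (t : ℝ) := t.2.1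
    have ht1 : 0 < 1 - (t : ℝ) := sub_pos.2 t.2.2
    have h1 := mul_nonneg ht1.le (hc0 p.1.1)
    have h2 := mul_nonneg ht0.le (hc0 p.1.2)
    have e1 := hcz _ ((mul_eq_zero.1 (by linarith : (1 - (t : ℝ)) * c p.1.1 = 0)).resolve_left
      ht1.ne')
    have e2 := hcz _ ((mul_eq_zero.1 (by linarith : (t : ℝ) * c p.1.2 = 0)).resolve_left ht0.ne')
    have hd := p.2.1
    rw [← e1, ← e2, dist_self] at hd
    linarith

open Classical in
theorem eq_of_pathDist_inner {p : AntiContractingPair X K} {t : Set.Ioo (0 : ℝ) 1}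
    {w : ContractionSpace X K} (h : pathDist (inner p t) w = 0) : inner p t = w := by
  let b : ℝ → ℝ := fun s => max 0 (min (t : ℝ) (1 - t) - |s - t|)
  let f : ContractionSpace X K → ℝ := fun z => match z with
    | incl _ => 0
    | inner q s => if q = p then b s else 0
  have ht0 : 0 < (t : ℝ) := t.2.1
  have ht1 : 0 < 1 - (t : ℝ) := sub_pos.2 t.2.2
  have hm : 0 < min (t : ℝ) (1 - t) := lt_min ht0 ht1
  have hb0 : b 0 = 0 := by
    simp only [b, zero_sub, abs_neg, abs_of_pos ht0]
    exact max_eq_left (by linarith [min_le_left (t : ℝ) (1 - t)])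
  have hb1 : b 1 = 0 := by
    simp only [b, abs_of_pos ht1]
    exact max_eq_left (by linarith [min_le_right (t : ℝ) (1 - t)])
  have hedge : ∀ q : AntiContractingPair X K, ∀ s ∈ Set.Icc (0 : ℝ) 1,
      f (edge q s) = if q = p then b s else 0 := by
    intro q s hs
    rcases eq_or_lt_of_le hs.1 with h0 | h0
    · rw [← h0, edge_zero, hb0]; simp [f]
    rcases eq_or_lt_of_le hs.2 with h1 | h1
    · rw [h1, edge_one, hb1]; simp [f]
    exact congrArg f (edge_of_mem q ⟨s, h0, h1⟩)
  have hf : ∀ z w a, IsStep z w a → |f z - f w| ≤ a := by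
    intro z w a hs
    cases hs with
    | base y z => simp [f, dist_nonneg]
    | along q s s' hs hs' =>
      rw [hedge q s hs, hedge q s' hs']
      split_ifs
      · refine (abs_max_sub_max_le_max _ _ _ _).trans (max_le (by simp) ?_)
        rw [sub_sub_sub_cancel_left]
        refine (abs_abs_sub_abs_le _ _).trans (le_of_eq ?_)
        rw [sub_sub_sub_cancel_right, abs_sub_comm]
      · simp
  have key := abs_sub_le_pathDist hf (inner p t) w
  have hx : f (inner p t) = min (t : ℝ) (1 - t) := by
    simp only [f, b, if_true, sub_self, abs_zero, sub_zero]
    exact max_eq_right hm.le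
  rw [h, hx] at key
  have hw : f w = min (t : ℝ) (1 - t) := (sub_eq_zero.1 (abs_nonpos_iff.1 key)).symm
  cases w with
  | incl y =>
    have : (0 : ℝ) = min (t : ℝ) (1 - t) := hw
    linarith
  | inner q s =>
    change (if q = p then b s else 0) = _ at hw
    split_ifs at hw with hq
    · subst hq
      have hs : (s : ℝ) = t := by
        by_contra hne
        have hpos : 0 < |(s : ℝ) - t| := abs_pos.2 (sub_ne_zero.2 hne)
        have : b s < min (t : ℝ) (1 - t) := max_lt hm (by linarith)
        linarith
      rw [Subtype.ext hs]
    · linarith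

noncomputable instance instMetricSpace : MetricSpace (ContractionSpace X K) where
  dist := pathDist
  dist_self := pathDist_self
  dist_comm := pathDist_comm
  dist_triangle := pathDist_triangle
  eq_of_dist_eq_zero {z w} h := by
    cases z with
    | incl x => exact eq_of_pathDist_incl h
    | inner p t => exact eq_of_pathDist_inner h

/-! ### The induced action -/

variable {G : Type v} [Group G] [MulAction G X] [IsIsometricSMul G X]

/-- The translate of an anti-contracting pair. -/
def smulPair (g : G) (p : AntiContractingPair X K) : AntiContractingPair X K :=
  ⟨(g • p.1.1, g • p.1.2), p.2.smul g⟩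

/-- `G` acts on the contraction space by extending the action on `X`; the interval attached along
`(x, y)` is carried to the interval attached along `(g x, g y)`. -/
instance instMulAction : MulAction G (ContractionSpace X K) where
  smul g z := match z with
    | incl x => incl (g • x)
    | inner p t => inner (smulPair g p) t
  one_smul z := by
    cases z with
    | incl x => exact congrArg incl (one_smul G x)
    | inner p t =>
      exact congrArg (inner · t)
        (Subtype.ext (Prod.ext (one_smul G p.1.1) (one_smul G p.1.2)))
  mul_smul g h z := by
    cases z with
    | incl x => exact congrArg incl (mul_smul g h x)
    | inner p t =>
      exact congrArg (inner · t)
        (Subtype.ext (Prod.ext (mul_smul g h p.1.1) (mul_smul g h p.1.2)))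

theorem smul_incl (g : G) (x : X) : g • (incl x : ContractionSpace X K) = incl (g • x) := rfl

theorem smul_inner (g : G) (p : AntiContractingPair X K) (t : Set.Ioo (0 : ℝ) 1) :
    g • inner p t = inner (smulPair g p) t := rfl

theorem smul_edge (g : G) (p : AntiContractingPair X K) (t : ℝ) :
    g • edge p t = edge (smulPair g p) t := by
  unfold edge
  split_ifs <;> rfl

theorem IsPathLength.smul (g : G) {z w : ContractionSpace X K} {a : ℝ}
    (h : IsPathLength z w a) : IsPathLength (g • z) (g • w) a := by
  induction h with
  | nil z => exact .nil _
  | cons hs _ ih =>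
    refine .cons ?_ ih
    cases hs with
    | base x y => rw [← dist_smul g x y]; exact .base _ _
    | along p s t hs ht => rw [smul_edge, smul_edge]; exact .along _ s t hs ht

instance instIsIsometricSMul : IsIsometricSMul G (ContractionSpace X K) where
  isometry_smul g := by
    refine Isometry.of_dist_eq fun z w => ?_
    change sInf _ = sInf _
    congr 1
    ext ℓ
    refine ⟨fun h => ?_, IsPathLength.smul g⟩
    simpa using IsPathLength.smul g⁻¹ h

end ContractionSpace

/-! ### Group actions -/

/-- The action is (metrically) proper: every bounded set meets only finitely many of its
translates. -/
def IsProperAction (G : Type v) (X : Type u) [Group G] [MetricSpace X] [MulAction G X] : Prop :=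
  ∀ B : Set X, Bornology.IsBounded B → {g : G | ((g • B) ∩ B).Nonempty}.Finite

/-- Gromov hyperbolicity (four-point condition; it does not need geodesics to exist). -/
def IsGromovHyperbolic (Y : Type u) [MetricSpace Y] : Prop :=
  ∃ δ : ℝ, ∀ x y z w : Y,
    dist x y + dist z w ≤ max (dist x z + dist y w) (dist x w + dist y z) + 2 * δ

/-- `G` acts non-uniformly acylindrically on the hyperbolic space `Y`. -/
def IsNonUniformlyAcylindrical (G : Type v) (Y : Type u) [Group G] [MetricSpace Y]
    [MulAction G Y] : Prop :=
  IsGromovHyperbolic Y ∧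
    ∀ R : ℝ, 0 < R → ∃ D : ℝ, 0 ≤ D ∧ ∀ x y : Y, D ≤ dist x y →
      {g : G | dist x (g • x) < R ∧ dist y (g • y) < R}.Finite

/-- `γ : ℝ → X` is a bi-infinite `C`-quasi-geodesic. -/
def IsQuasiGeodesicLine {X : Type u} [MetricSpace X] (C : ℝ) (γ : ℝ → X) : Prop :=
  1 ≤ C ∧ Continuous γ ∧
    ∀ s t : ℝ, |s - t| / C - C ≤ dist (γ s) (γ t) ∧ dist (γ s) (γ t) ≤ C * |s - t| + C

/-- The closest point projection of `x` to `S`, as a set. -/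
def closestPoints {X : Type u} [MetricSpace X] (S : Set X) (x : X) : Set X :=
  {p | p ∈ S ∧ ∀ q ∈ S, dist x p ≤ dist x q}

/-- `S` is `C`-contracting: for every `x`, the projection to `S` of the open ball around `x` of
radius `d(x, S)` has diameter at most `C`. -/
def IsContracting {X : Type u} [MetricSpace X] (C : ℝ) (S : Set X) : Prop :=
  ∀ x : X, ∀ y ∈ Metric.ball x (Metric.infDist x S), ∀ z ∈ Metric.ball x (Metric.infDist x S),
    ∀ p ∈ closestPoints S y, ∀ q ∈ closestPoints S z, dist p q ≤ C

/-- `g` is loxodromic: `n ↦ g ^ n • x` is a quasi-isometric embedding of `ℤ` for some `x`. -/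
def IsLoxodromic {G : Type v} (X : Type u) [Group G] [MetricSpace X] [MulAction G X]
    (g : G) : Prop :=
  ∃ (x : X) (L : ℝ), 1 ≤ L ∧ ∀ m n : ℤ,
    |(m : ℝ) - n| / L - L ≤ dist (g ^ m • x) (g ^ n • x) ∧
      dist (g ^ m • x) (g ^ n • x) ≤ L * |(m : ℝ) - n| + L

/-- The axis of `g` in `X` is strongly contracting: `g` is loxodromic and, for some `C`, it
stabilizes a bi-infinite `C`-contracting `C`-quasi-geodesic. -/
def HasStronglyContractingAxis {G : Type v} (X : Type u) [Group G] [MetricSpace X]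
    [MulAction G X] (g : G) : Prop :=
  IsLoxodromic X g ∧ ∃ (C : ℝ) (γ : ℝ → X), IsQuasiGeodesicLine C γ ∧
    IsContracting C (Set.range γ) ∧ g • Set.range γ = Set.range γ

/-- Every orbit of `G` in `Y` is unbounded. -/
def HasUnboundedOrbits (G : Type v) (Y : Type u) [Group G] [MetricSpace Y]
    [MulAction G Y] : Prop :=
  ∀ y : Y, ¬ Bornology.IsBounded (MulAction.orbit G y)

end ContractionSpaces

/-! Everything is done with the distance `hatDist` that the contraction space induces on `X`; every
point of the contraction space is within one of `X`.

Hyperbolicity rests on one observation. Let `m` lie on a side of a geodesic triangle of `X` and let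
`m'` be a point of the other two sides closest to `m`. Then `hatDist m m' ≤ 1`
(`hatDist_closest_le`). Otherwise `(m, m')` is not anti-contracting, so a geodesic from `m` to `m'`
carries an `r`-thin segment of length at least `4r + 1`. By minimality the `r`-ball around its
midpoint misses the other two sides, so thinness forces both halves of the first side to enter that
ball, and the first side backtracks. Hence triangles of `X`-geodesics are 1-thin for `hatDist`. As
for the Morse lemma, a logarithmic estimate followed by a bootstrap shows that `X`-geodesics stay
close to chains of points almost realising `hatDist` (`IsGoodChain.exists_near`), so they do not
backtrack for `hatDist` (`hatDist_add_le`). The four-point inequality follows.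

For acylindricity, points at `hatDist` more than one are not anti-contracting, so a geodesic from
`x` to `y` of large `hatDist` carries three successive bottlenecks, centred at thin segments, far
from both ends. If `g` moves `x` and `y` little, the quadrangle `x, y, gy, gx` must come close to
the middle one. The sides `[y, gy]` and `[gx, x]` cannot do so, because the outer bottlenecks screen
the middle one from them. So the translate of the geodesic does, and properness leaves finitely many
`g` (`finite_hatDist_lt`).

For unbounded orbits, a geodesic whose ends project far apart on a contracting line follows the
line, and contains thin segments of any prescribed large length (`exists_isThin`). As the gauge is
finite, anti-contracting pairs have projections at bounded distance, and so the projection is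
coarsely Lipschitz for `hatDist` (`exists_abs_proj_sub_le`). A bounded orbit would then bound the
powers of `g` along its axis. -/

namespace ContractionSpaces

universe u v

/-! ### Betweenness and geodesic segments -/

/-- `m` lies on a geodesic from `x` to `y`. -/
def Btw {X : Type u} [MetricSpace X] (x m y : X) : Prop :=
  dist x m + dist m y = dist x y

section Segments

variable {X : Type u} [MetricSpace X]

theorem Btw.symm {x m y : X} (h : Btw x m y) : Btw y m x := by
  unfold Btw at *
  rw [dist_comm y m, dist_comm m x, dist_comm y x]
  linarith

theorem btw_right (x y : X) : Btw x y y := by simp [Btw]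

theorem Btw.dist_le_left {x m y : X} (h : Btw x m y) : dist x m ≤ dist x y := by
  unfold Btw at h
  linarith [dist_nonneg (x := m) (y := y)]

theorem Btw.dist_le_right {x m y : X} (h : Btw x m y) : dist m y ≤ dist x y := by
  unfold Btw at h
  linarith [dist_nonneg (x := x) (y := m)]

/-- If `x, a, m, y` lie in this order on a geodesic, then `m` is between `a` and `y`. -/
theorem Btw.mid {x a m y : X} (h : Btw x m y) (h' : Btw x a m) : Btw a m y := by
  unfold Btw at *
  linarith [dist_triangle a m y, dist_triangle x a y]

theorem Btw.dist_add {x m y a b : X} (h : Btw x m y) (ha : Btw x a m) (hb : Btw m b y) :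
    dist a m + dist m b = dist a b := by
  unfold Btw at *
  linarith [dist_triangle a m b, dist_triangle x a b, dist_triangle x b y]

namespace GeodesicSegment

theorem dist_toFun (γ : GeodesicSegment X) {s t : ℝ} (hs : s ∈ Set.Icc 0 γ.len)
    (ht : t ∈ Set.Icc 0 γ.len) (hst : s ≤ t) : dist (γ.toFun s) (γ.toFun t) = t - s := by
  rw [γ.isom s hs t ht, abs_sub_comm, abs_of_nonneg (by linarith)]

theorem zero_mem (γ : GeodesicSegment X) : (0 : ℝ) ∈ Set.Icc 0 γ.len := ⟨le_rfl, γ.len_nonneg⟩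

theorem len_mem (γ : GeodesicSegment X) : γ.len ∈ Set.Icc 0 γ.len := ⟨γ.len_nonneg, le_rfl⟩

theorem len_eq (γ : GeodesicSegment X) : γ.len = dist γ.source γ.target := by
  have := γ.dist_toFun γ.zero_mem γ.len_mem γ.len_nonneg
  unfold source target
  linarith

theorem btw_toFun (γ : GeodesicSegment X) {r s t : ℝ} (hr : 0 ≤ r) (hrs : r ≤ s) (hst : s ≤ t)
    (ht : t ≤ γ.len) : Btw (γ.toFun r) (γ.toFun s) (γ.toFun t) := by
  unfold Btw
  rw [γ.dist_toFun ⟨hr, by linarith⟩ ⟨by linarith, by linarith⟩ hrs,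
    γ.dist_toFun ⟨by linarith, by linarith⟩ ⟨by linarith, by linarith⟩ hst,
    γ.dist_toFun ⟨hr, by linarith⟩ ⟨by linarith, by linarith⟩ (hrs.trans hst)]
  ring

theorem btw_of_mem (γ : GeodesicSegment X) {p : X} (hp : p ∈ γ.image) :
    Btw γ.source p γ.target := by
  obtain ⟨t, ht, rfl⟩ := hp
  exact γ.btw_toFun le_rfl ht.1 ht.2 le_rfl

theorem source_mem (γ : GeodesicSegment X) : γ.source ∈ γ.image := ⟨0, γ.zero_mem, rfl⟩

theorem target_mem (γ : GeodesicSegment X) : γ.target ∈ γ.image := ⟨γ.len, γ.len_mem, rfl⟩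

theorem continuousOn (γ : GeodesicSegment X) : ContinuousOn γ.toFun (Set.Icc 0 γ.len) := by
  refine LipschitzOnWith.continuousOn (K := 1) (LipschitzOnWith.of_dist_le_mul ?_)
  intro s hs t ht
  rw [γ.isom s hs t ht, Real.dist_eq]
  simp

theorem isCompact_image (γ : GeodesicSegment X) : IsCompact γ.image :=
  isCompact_Icc.image_of_continuousOn γ.continuousOn

/-- The constant segment. -/
def const (x : X) : GeodesicSegment X where
  len := 0
  toFun _ := x
  len_nonneg := le_rfl
  isom s hs t ht := by
    have h1 : s = 0 := le_antisymm hs.2 hs.1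
    have h2 : t = 0 := le_antisymm ht.2 ht.1
    simp [h1, h2]

theorem image_const (x : X) : (const x).image = {x} := by
  simp [image, const]

/-- The restriction of a segment to `[s, t]`. -/
def sub (γ : GeodesicSegment X) (s t : ℝ) (hs : 0 ≤ s) (hst : s ≤ t) (ht : t ≤ γ.len) :
    GeodesicSegment X where
  len := t - s
  toFun w := γ.toFun (s + w)
  len_nonneg := by linarith
  isom a ha b hb := by
    rw [γ.isom _ ⟨by linarith [ha.1], by linarith [ha.2]⟩ _ ⟨by linarith [hb.1], by linarith [hb.2]⟩]
    congr 1
    ring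

/-- The segment run backwards. -/
def rev (γ : GeodesicSegment X) : GeodesicSegment X where
  len := γ.len
  toFun w := γ.toFun (γ.len - w)
  len_nonneg := γ.len_nonneg
  isom a ha b hb := by
    rw [γ.isom _ ⟨by linarith [ha.2], by linarith [ha.1]⟩ _ ⟨by linarith [hb.2], by linarith [hb.1]⟩,
      abs_sub_comm]
    congr 1
    ring

theorem source_rev (γ : GeodesicSegment X) : γ.rev.source = γ.target := by
  simp [source, target, rev]

theorem target_rev (γ : GeodesicSegment X) : γ.rev.target = γ.source := by
  simp [source, target, rev]

theorem image_rev (γ : GeodesicSegment X) : γ.rev.image = γ.image := by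
  ext p
  constructor
  · rintro ⟨t, ht, rfl⟩
    exact ⟨γ.len - t, ⟨by linarith [ht.2, show γ.rev.len = γ.len from rfl], by linarith [ht.1]⟩, rfl⟩
  · rintro ⟨t, ht, rfl⟩
    refine ⟨γ.len - t, ⟨by linarith [ht.2], ?_⟩, ?_⟩
    · change γ.len - t ≤ γ.len
      linarith [ht.1]
    · simp [rev]

theorem exists_to_target (γ : GeodesicSegment X) {p : X} (hp : p ∈ γ.image) :
    ∃ δ : GeodesicSegment X, δ.source = p ∧ δ.target = γ.target ∧ δ.image ⊆ γ.image := by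
  obtain ⟨t, ht, rfl⟩ := hp
  refine ⟨γ.sub t γ.len ht.1 ht.2 le_rfl, by simp [source, sub], by simp [target, sub], ?_⟩
  rintro _ ⟨s, hs, rfl⟩
  have h2 : s ≤ γ.len - t := hs.2
  exact ⟨t + s, ⟨by linarith [hs.1, ht.1], by linarith⟩, rfl⟩

theorem exists_to_source (γ : GeodesicSegment X) {p : X} (hp : p ∈ γ.image) :
    ∃ δ : GeodesicSegment X, δ.source = p ∧ δ.target = γ.source ∧ δ.image ⊆ γ.image := by
  rw [← image_rev] at hp ⊢
  rw [← target_rev]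
  exact exists_to_target _ hp

theorem IsSubsegment.trans {γ₁ γ₂ γ₃ : GeodesicSegment X} (h : γ₁.IsSubsegment γ₂)
    (h' : γ₂.IsSubsegment γ₃) : γ₁.IsSubsegment γ₃ := by
  obtain ⟨s, hs, hl, hf⟩ := h
  obtain ⟨s', hs', hl', hf'⟩ := h'
  refine ⟨s' + s, by linarith, by linarith, fun t ht => ?_⟩
  rw [hf t ht, hf' _ ⟨by linarith [ht.1], by linarith [ht.2]⟩, add_assoc]

open Classical in
/-- Geodesics `x → m` and `m → y` with `m` between `x` and `y` concatenate to a geodesic. -/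
theorem exists_concat (γ₁ γ₂ : GeodesicSegment X) (h : γ₁.target = γ₂.source)
    (hb : Btw γ₁.source γ₁.target γ₂.target) :
    ∃ γ : GeodesicSegment X, γ.source = γ₁.source ∧ γ.target = γ₂.target ∧
      γ₁.IsSubsegment γ ∧ γ₂.IsSubsegment γ := by
  have hl : γ₁.len + γ₂.len = dist γ₁.source γ₂.target := by
    rw [γ₁.len_eq, γ₂.len_eq, ← h]; exact hb
  have n1 := γ₁.len_nonneg
  have n2 := γ₂.len_nonneg
  have cross : ∀ s ∈ Set.Icc 0 γ₁.len, ∀ t ∈ Set.Icc 0 γ₂.len,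
      dist (γ₁.toFun s) (γ₂.toFun t) = γ₁.len + t - s := by
    intro s hs t ht
    have e1 := γ₁.dist_toFun γ₁.zero_mem hs hs.1
    have e2 := γ₁.dist_toFun hs γ₁.len_mem hs.2
    have e3 := γ₂.dist_toFun γ₂.zero_mem ht ht.1
    have e4 := γ₂.dist_toFun ht γ₂.len_mem ht.2
    have h' : γ₁.toFun γ₁.len = γ₂.toFun 0 := h
    rw [h'] at e2
    have t1 := dist_triangle (γ₁.toFun s) (γ₂.toFun 0) (γ₂.toFun t)
    have t2 := dist_triangle4 (γ₁.toFun 0) (γ₁.toFun s) (γ₂.toFun t) (γ₂.toFun γ₂.len)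
    unfold source target at hl
    linarith
  refine ⟨⟨γ₁.len + γ₂.len, fun t => if t ≤ γ₁.len then γ₁.toFun t else γ₂.toFun (t - γ₁.len),
    by linarith, ?_⟩, ?_, ?_, ⟨0, le_rfl, ?_, ?_⟩, ⟨γ₁.len, n1, le_rfl, ?_⟩⟩
  · intro s hs t ht
    split_ifs with h1 h2 h2
    · exact γ₁.isom s ⟨hs.1, h1⟩ t ⟨ht.1, h2⟩
    · push Not at h2
      rw [cross s ⟨hs.1, h1⟩ _ ⟨by linarith, by linarith [ht.2]⟩, abs_sub_comm,
        abs_of_nonneg (by linarith)]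
      ring
    · push Not at h1
      rw [dist_comm, cross t ⟨ht.1, h2⟩ _ ⟨by linarith, by linarith [hs.2]⟩,
        abs_of_nonneg (by linarith)]
      ring
    · push Not at h1 h2
      rw [γ₂.isom _ ⟨by linarith, by linarith [hs.2]⟩ _ ⟨by linarith, by linarith [ht.2]⟩]
      congr 1
      ring
  · simp [source, n1]
  · by_cases h0 : γ₂.len ≤ 0
    · have : γ₂.len = 0 := le_antisymm h0 n2
      have h' : γ₁.toFun γ₁.len = γ₂.toFun 0 := h
      simp [target, this, h']
    · simp [target, h0]
  · change 0 + γ₁.len ≤ γ₁.len + γ₂.len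
    linarith
  · intro t ht
    simp [ht.2]
  · intro t ht
    by_cases h0 : t ≤ 0
    · have : t = 0 := le_antisymm h0 ht.1
      have h' : γ₁.toFun γ₁.len = γ₂.toFun 0 := h
      simp [this, h']
    · simp [h0]

end GeodesicSegment

open GeodesicSegment

theorem IsGeodesicSpace.exists_through (hX : IsGeodesicSpace X) {x m y : X} (h : Btw x m y) :
    ∃ γ : GeodesicSegment X, γ.source = x ∧ γ.target = y ∧ m ∈ γ.image := by
  obtain ⟨γ₁, hs1, ht1⟩ := hX x m
  obtain ⟨γ₂, hs2, ht2⟩ := hX m y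
  obtain ⟨γ, hs, ht, ⟨s, hs0, hl, hf⟩, -⟩ := exists_concat γ₁ γ₂ (ht1.trans hs2.symm)
    (by rw [hs1, ht1, ht2]; exact h)
  refine ⟨γ, hs.trans hs1, ht.trans ht2, s + γ₁.len, ⟨by linarith [γ₁.len_nonneg], hl⟩, ?_⟩
  rw [← hf _ γ₁.len_mem]
  exact ht1

/-- Every geodesic from `a` to `b` is a subsegment of one from `x` to `y` when `x, a, b, y` lie in
this order on a geodesic. -/
theorem IsGeodesicSpace.exists_extension (hX : IsGeodesicSpace X) {x a b y : X}
    (h : dist x a + dist a b + dist b y = dist x y) (γ : GeodesicSegment X) (hs : γ.source = a)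
    (ht : γ.target = b) :
    ∃ δ : GeodesicSegment X, δ.source = x ∧ δ.target = y ∧ γ.IsSubsegment δ := by
  obtain ⟨γ₁, hs1, ht1⟩ := hX x a
  obtain ⟨γ₂, hs2, ht2⟩ := hX b y
  have hxb : Btw x a b := by
    unfold Btw
    linarith [dist_triangle x a b, dist_triangle x b y]
  obtain ⟨δ, hδs, hδt, -, hsub⟩ := exists_concat γ₁ γ (ht1.trans hs.symm)
    (by rw [hs1, ht1, ht]; exact hxb)
  obtain ⟨ε, hεs, hεt, hsub', -⟩ := exists_concat δ γ₂ (hδt.trans (ht.trans hs2.symm)) (by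
    rw [hδs, hδt, hs1, ht, ht2]
    unfold Btw at *
    linarith)
  exact ⟨ε, hεs.trans (hδs.trans hs1), hεt.trans ht2, hsub.trans hsub'⟩

/-! ### Anti-contracting pairs and bottlenecks -/

variable {K : ℝ≥0 → ℝ≥0∞}

/-- A geodesic from `a` to `b` extends to one from `x` to `y`, so a thin subsegment of the former is
one of the latter. -/
theorem IsAntiContracting.mono (hX : IsGeodesicSpace X) {x a b y : X}
    (h : IsAntiContracting K x y) (hab : dist x a + dist a b + dist b y = dist x y)
    (h1 : 1 ≤ dist a b) : IsAntiContracting K a b := by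
  refine ⟨h1, fun r γ γ' hs ht hsub hr => ?_⟩
  obtain ⟨δ, hδs, hδt, hδ⟩ := hX.exists_extension hab γ hs ht
  exact h.2 r δ γ' hδs hδt (hsub.trans hδ) hr

/-- `m` is between `a` and `b`, far from both compared to `r`, and every path made of three
geodesics that joins the ends of a geodesic through `a` and `b` passes `r`-close to `m`. -/
structure IsBottleneck (a b m : X) (r : ℝ) : Prop where
  btw : Btw a m b
  nonneg : 0 ≤ r
  left : 4 * r + 1 ≤ 2 * dist a m
  right : 4 * r + 1 ≤ 2 * dist m b
  meets : ∀ x y : X, dist x a + dist a b + dist b y = dist x y →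
    ∀ γ₂ γ₃ γ₄ : GeodesicSegment X, γ₂.source = y → γ₂.target = γ₃.source →
      γ₃.target = γ₄.source → γ₄.target = x →
      ∃ p ∈ γ₂.image ∪ γ₃.image ∪ γ₄.image, dist p m ≤ r

theorem IsBottleneck.symm {a b m : X} {r : ℝ} (h : IsBottleneck a b m r) :
    IsBottleneck b a m r := by
  refine ⟨h.btw.symm, h.nonneg, by rw [dist_comm]; exact h.right, by rw [dist_comm]; exact h.left,
    fun x y hxy γ₂ γ₃ γ₄ h1 h2 h3 h4 => ?_⟩
  obtain ⟨p, hp, hpm⟩ := h.meets y x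
    (by rw [dist_comm y a, dist_comm a b, dist_comm b x, dist_comm y x]; linarith)
    γ₄.rev γ₃.rev γ₂.rev (by rw [source_rev, h4]) (by rw [target_rev, source_rev, h3])
    (by rw [target_rev, source_rev, h2]) (by rw [target_rev, h1])
  refine ⟨p, ?_, hpm⟩
  simp only [image_rev] at hp
  rcases hp with (hp | hp) | hp
  · exact Or.inr hp
  · exact Or.inl (Or.inr hp)
  · exact Or.inl (Or.inl hp)

/-- The midpoint of a thin subsegment of length at least `4r + 1` has at least `2r + 1/2` of
geodesic on either side. Only the bound `K r ≥ 4r + 1` enters, and this margin is all that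
hyperbolicity needs. -/
theorem exists_isBottleneck (hX : IsGeodesicSpace X) (hK : IsContractionGauge K) {a b : X}
    (h1 : 1 ≤ dist a b) (h : ¬ IsAntiContracting K a b) : ∃ m r, IsBottleneck a b m r := by
  unfold IsAntiContracting at h
  push Not at h
  obtain ⟨r, γ, γ', hs, ht, hsub, hKr, hthin⟩ := h h1
  have hlen : 4 * (r : ℝ) + 1 ≤ γ'.len := by
    have := (hK.le_apply r).trans hKr
    have h4 : 4 * (r : ℝ≥0∞) + 1 = ENNReal.ofReal (4 * (r : ℝ) + 1) := by
      rw [ENNReal.ofReal_add (by positivity) (by norm_num), ENNReal.ofReal_mul (by norm_num)]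
      simp
    rw [h4, ENNReal.ofReal_le_ofReal_iff γ'.len_nonneg] at this
    exact this
  have hr := r.2
  obtain ⟨s, hs0, hl, hf⟩ := id hsub
  have n := γ'.len_nonneg
  have hm : γ'.midpoint = γ.toFun (s + γ'.len / 2) :=
    hf (γ'.len / 2) ⟨by linarith, by linarith⟩
  have hmem : s + γ'.len / 2 ∈ Set.Icc 0 γ.len := ⟨by linarith, by linarith⟩
  have d1 := γ.dist_toFun γ.zero_mem hmem hmem.1
  have d2 := γ.dist_toFun hmem γ.len_mem hmem.2
  refine ⟨γ'.midpoint, r, ?_, r.2, ?_, ?_, ?_⟩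
  · rw [hm, ← hs, ← ht]
    exact γ.btw_of_mem ⟨_, hmem, rfl⟩
  · rw [hm, ← hs]
    unfold source
    linarith
  · rw [hm, ← ht]
    unfold target
    linarith
  · intro x y hxy γ₂ γ₃ γ₄ e1 e2 e3 e4
    obtain ⟨δ, hδs, hδt, hδ⟩ := hX.exists_extension hxy γ hs ht
    obtain ⟨p, hp, hp'⟩ := hthin δ γ₂ γ₃ γ₄ (hδt.trans e1.symm) e2 e3 (e4.trans hδs.symm)
      (hsub.trans hδ)
    exact ⟨p, hp, hp'⟩

/-! ### The distance of the contraction space, restricted to `X` -/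

variable (K) in
/-- The distance in the contraction space of two points of `X`. -/
noncomputable def hatDist (x y : X) : ℝ :=
  dist (ContractionSpace.incl x : ContractionSpace X K) (ContractionSpace.incl y)

theorem hatDist_self (x : X) : hatDist K x x = 0 := dist_self _

theorem hatDist_comm (x y : X) : hatDist K x y = hatDist K y x := dist_comm _ _

theorem hatDist_nonneg (x y : X) : 0 ≤ hatDist K x y := dist_nonneg

theorem hatDist_triangle (x y z : X) : hatDist K x z ≤ hatDist K x y + hatDist K y z :=
  dist_triangle _ _ _

theorem hatDist_le_dist (x y : X) : hatDist K x y ≤ dist x y :=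
  csInf_le (ContractionSpace.bddBelow_pathLengths _ _)
    (ContractionSpace.IsStep.base x y).isPathLength

theorem IsAntiContracting.hatDist_le {x y : X} (h : IsAntiContracting K x y) :
    hatDist K x y ≤ 1 := by
  obtain ⟨p, hp⟩ : ∃ p : AntiContractingPair X K, p.1 = (x, y) := ⟨⟨(x, y), h⟩, rfl⟩
  have hst := ContractionSpace.IsStep.along p 0 1 (by simp) (by simp)
  rw [ContractionSpace.edge_zero, ContractionSpace.edge_one, hp] at hst
  have := csInf_le (ContractionSpace.bddBelow_pathLengths _ _) hst.isPathLength
  exact this.trans (by simp)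

theorem continuous_hatDist (x : X) : Continuous fun y => hatDist K x y := by
  refine LipschitzWith.continuous (K := 1) (LipschitzWith.of_dist_le_mul fun y z => ?_)
  rw [Real.dist_eq, abs_le]
  have h1 := hatDist_triangle (K := K) x y z
  have h2 := hatDist_triangle (K := K) x z y
  have h3 := hatDist_le_dist (K := K) y z
  rw [hatDist_comm z y] at h2
  constructor <;> simp <;> linarith

/-- The closest point on two sides of a triangle to a point of the third side is at distance at
most one in the contraction space. -/
theorem hatDist_closest_le_aux (hX : IsGeodesicSpace X) (hK : IsContractionGauge K)
    {x y m m' : X} (hm : Btw x m y) (β β' : GeodesicSegment X) (hβs : β.source = x)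
    (hββ : β.target = β'.source) (hβt : β'.target = y) (hm' : m' ∈ β.image)
    (hmin : ∀ q ∈ β.image ∪ β'.image, dist m m' ≤ dist m q) : hatDist K m m' ≤ 1 := by
  by_contra hcon
  push Not at hcon
  have hd : 1 ≤ dist m m' := hcon.le.trans (hatDist_le_dist _ _)
  obtain ⟨q, r, hq⟩ := exists_isBottleneck hX hK hd
    (fun h => absurd h.hatDist_le (not_le.2 hcon))
  have hqm := hq.btw
  have h0 := hq.nonneg
  have h1 := hq.left
  have h2 := hq.right
  unfold Btw at hqm
  -- Such a `p` would be closer to `m` than `m'` is: `d(m,p) ≤ d(m,q) + r < d(m,q) + d(q,m')`.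
  have hfar : ∀ p ∈ β.image ∪ β'.image, ¬ dist p q ≤ r := by
    intro p hp hpq
    have := hmin p hp
    have t := dist_triangle m q p
    rw [dist_comm q p] at t
    linarith
  obtain ⟨δ₁, hδ1s, hδ1t, hδ1⟩ := β.exists_to_source hm'
  obtain ⟨δ₂, hδ2s, hδ2t, hδ2⟩ := β.exists_to_target hm'
  obtain ⟨α₁, hα1s, hα1t⟩ := hX x m
  obtain ⟨α₂, hα2s, hα2t⟩ := hX y m
  have hmm : dist m m + dist m m' + dist m' m' = dist m m' := by simp
  obtain ⟨u, hu, huq⟩ : ∃ u, Btw x u m ∧ dist u q ≤ r := by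
    obtain ⟨p, hp, hpq⟩ := hq.meets m m' hmm δ₁ α₁ (const m) hδ1s
      (hδ1t.trans (hβs.trans hα1s.symm)) hα1t rfl
    rcases hp with (hp | hp) | hp
    · exact absurd hpq (hfar p (Or.inl (hδ1 hp)))
    · exact ⟨p, hα1s ▸ hα1t ▸ α₁.btw_of_mem hp, hpq⟩
    · rw [image_const] at hp
      exact ⟨p, hp ▸ btw_right _ _, hpq⟩
  obtain ⟨v, hv, hvq⟩ : ∃ v, Btw m v y ∧ dist v q ≤ r := by
    obtain ⟨p, hp, hpq⟩ := hq.meets m m' hmm δ₂ β' α₂ hδ2s (hδ2t.trans hββ)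
      (hβt.trans hα2s.symm) hα2t
    rcases hp with (hp | hp) | hp
    · exact absurd hpq (hfar p (Or.inl (hδ2 hp)))
    · exact absurd hpq (hfar p (Or.inr hp))
    · exact ⟨p, (hα2s ▸ hα2t ▸ α₂.btw_of_mem hp : Btw y p m).symm, hpq⟩
  -- Both `u` and `v` are `r`-close to `q`, so `d(u,v) ≤ 2r`; but each is at least `r + 1/2` from
  -- `m`, which lies between them.
  have huv := hm.dist_add hu hv
  have t1 := dist_triangle u q v
  have t2 := dist_triangle m u q
  have t3 := dist_triangle m v q
  rw [dist_comm q v] at t1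
  rw [dist_comm m u] at t2
  linarith

theorem hatDist_closest_le (hX : IsGeodesicSpace X) (hK : IsContractionGauge K)
    {x y m m' : X} (hm : Btw x m y) (β β' : GeodesicSegment X) (hβs : β.source = x)
    (hββ : β.target = β'.source) (hβt : β'.target = y) (hm' : m' ∈ β.image ∪ β'.image)
    (hmin : ∀ q ∈ β.image ∪ β'.image, dist m m' ≤ dist m q) : hatDist K m m' ≤ 1 := by
  rcases hm' with h | h
  · exact hatDist_closest_le_aux hX hK hm β β' hβs hββ hβt h hmin
  · refine hatDist_closest_le_aux hX hK hm.symm β'.rev β.rev (by rw [source_rev, hβt])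
      (by rw [target_rev, source_rev, hββ]) (by rw [target_rev, hβs]) (by rw [image_rev]; exact h) ?_
    intro q hq
    rw [image_rev, image_rev, Set.union_comm] at hq
    exact hmin q hq

/-- Geodesic triangles of `X` are thin in the contraction space. -/
theorem exists_hatDist_le_one (hX : IsGeodesicSpace X) (hK : IsContractionGauge K) {x m y : X}
    (hm : Btw x m y) (z : X) : ∃ q, (Btw x q z ∨ Btw z q y) ∧ hatDist K m q ≤ 1 := by
  obtain ⟨β, hs, ht⟩ := hX x z
  obtain ⟨β', hs', ht'⟩ := hX z y
  obtain ⟨q, hq, hmin⟩ := (β.isCompact_image.union β'.isCompact_image).exists_isMinOn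
    ⟨_, Or.inl β.source_mem⟩ (f := fun q => dist m q) (by fun_prop)
  refine ⟨q, ?_, hatDist_closest_le hX hK hm β β' hs (ht.trans hs'.symm) ht' hq hmin⟩
  rcases hq with hq | hq
  · exact Or.inl (hs ▸ ht ▸ β.btw_of_mem hq)
  · exact Or.inr (hs' ▸ ht' ▸ β'.btw_of_mem hq)

/-- Some point of a side of a geodesic triangle is close to both other sides. -/
theorem exists_centre (hX : IsGeodesicSpace X) (hK : IsContractionGauge K) (x y w : X) :
    ∃ p u v, Btw x p y ∧ Btw x u w ∧ Btw w v y ∧ hatDist K p u ≤ 1 ∧ hatDist K p v ≤ 1 := by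
  obtain ⟨α, hαs, hαt⟩ := hX x y
  obtain ⟨β, hs, ht⟩ := hX x w
  obtain ⟨β', hs', ht'⟩ := hX w y
  -- By the intermediate value theorem some point of the side is equidistant from the other two; its
  -- closest points on each are then closest on their union.
  let f : X → ℝ := fun p => Metric.infDist p β.image - Metric.infDist p β'.image
  have hf : Continuous f := by fun_prop
  have hfα : ContinuousOn (fun t => f (α.toFun t)) (Set.Icc 0 α.len) :=
    hf.comp_continuousOn α.continuousOn
  obtain ⟨t, htm, hft⟩ : (0 : ℝ) ∈ (fun t => f (α.toFun t)) '' Set.Icc 0 α.len := by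
    refine intermediate_value_Icc α.len_nonneg hfα ⟨?_, ?_⟩
    · have : Metric.infDist (α.toFun 0) β.image = 0 := by
        have e : α.toFun 0 = β.source := hαs.trans hs.symm
        rw [e]
        exact Metric.infDist_zero_of_mem β.source_mem
      simp only [f, this, zero_sub, Left.neg_nonpos_iff]
      exact Metric.infDist_nonneg
    · have : Metric.infDist (α.toFun α.len) β'.image = 0 := by
        have e : α.toFun α.len = β'.target := hαt.trans ht'.symm
        rw [e]
        exact Metric.infDist_zero_of_mem β'.target_mem
      simp only [f, this, sub_zero]
      exact Metric.infDist_nonneg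
  have heq : Metric.infDist (α.toFun t) β.image = Metric.infDist (α.toFun t) β'.image :=
    sub_eq_zero.1 hft
  have hp : Btw x (α.toFun t) y := hαs ▸ hαt ▸ α.btw_of_mem ⟨t, htm, rfl⟩
  obtain ⟨u, hu, hud⟩ := β.isCompact_image.exists_infDist_eq_dist ⟨_, β.source_mem⟩ (α.toFun t)
  obtain ⟨v, hv, hvd⟩ := β'.isCompact_image.exists_infDist_eq_dist ⟨_, β'.source_mem⟩ (α.toFun t)
  have hle : ∀ q ∈ β.image ∪ β'.image, Metric.infDist (α.toFun t) β.image ≤ dist (α.toFun t) q := by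
    rintro q (hq | hq)
    · exact Metric.infDist_le_dist_of_mem hq
    · rw [heq]; exact Metric.infDist_le_dist_of_mem hq
  refine ⟨α.toFun t, u, v, hp, hs ▸ ht ▸ β.btw_of_mem hu, hs' ▸ ht' ▸ β'.btw_of_mem hv, ?_, ?_⟩
  · exact hatDist_closest_le hX hK hp β β' hs (ht.trans hs'.symm) ht' (Or.inl hu)
      (hud ▸ hle)
  · exact hatDist_closest_le hX hK hp β β' hs (ht.trans hs'.symm) ht' (Or.inr hv)
      (hvd ▸ heq ▸ hle)

end Segments

section Hyperbolicity

variable {X : Type u} [MetricSpace X] {K : ℝ≥0 → ℝ≥0∞}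

open GeodesicSegment

/-! ### Chains computing the distance of the contraction space -/

/-- A function on `X` that is `1`-Lipschitz and varies by at most one along anti-contracting pairs
is `1`-Lipschitz for the distance of the contraction space. -/
theorem abs_sub_le_hatDist {f : X → ℝ} (h1 : ∀ x y, |f x - f y| ≤ dist x y)
    (h2 : ∀ x y, IsAntiContracting K x y → |f x - f y| ≤ 1) (x y : X) :
    |f x - f y| ≤ hatDist K x y := by
  let F : ContractionSpace X K → ℝ := fun z => match z with
    | .incl y => f y
    | .inner p t => (1 - t) * f p.1.1 + t * f p.1.2
  have hedge : ∀ p : AntiContractingPair X K, ∀ t ∈ Set.Icc (0 : ℝ) 1,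
      F (ContractionSpace.edge p t) = (1 - t) * f p.1.1 + t * f p.1.2 := by
    intro p t ht
    rcases eq_or_lt_of_le ht.1 with h0 | h0
    · rw [← h0, ContractionSpace.edge_zero]; simp [F]
    rcases eq_or_lt_of_le ht.2 with h1 | h1
    · rw [h1, ContractionSpace.edge_one]; simp [F]
    exact congrArg F (ContractionSpace.edge_of_mem p ⟨t, h0, h1⟩)
  refine ContractionSpace.abs_sub_le_pathDist (f := F) ?_ (.incl x) (.incl y)
  intro z w a hs
  cases hs with
  | base y z => exact h1 y z
  | along p s t hs ht =>
    rw [hedge p s hs, hedge p t ht]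
    have e : (1 - s) * f p.1.1 + s * f p.1.2 - ((1 - t) * f p.1.1 + t * f p.1.2)
        = (t - s) * (f p.1.1 - f p.1.2) := by ring
    rw [e, abs_mul, abs_sub_comm t s]
    exact mul_le_of_le_one_right (abs_nonneg _) (h2 _ _ p.2)

variable (K) in
/-- `x` and `y` are at distance at most one or an anti-contracting pair, in some order. -/
def Adj (x y : X) : Prop :=
  dist x y ≤ 1 ∨ IsAntiContracting K x y ∨ IsAntiContracting K y x

theorem Adj.hatDist_le {x y : X} (h : Adj K x y) : hatDist K x y ≤ min (dist x y) 1 := by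
  refine le_min (hatDist_le_dist x y) ?_
  rcases h with h | h | h
  · exact (hatDist_le_dist x y).trans h
  · exact h.hatDist_le
  · rw [hatDist_comm]; exact h.hatDist_le

/-- By `IsAntiContracting.mono`, initial pieces of an `X`-geodesic joining an anti-contracting pair
are anti-contracting themselves once they have length at least one. -/
theorem Adj.hatDist_btw_le (hX : IsGeodesicSpace X) {x p y : X} (h : Adj K x y)
    (hp : Btw x p y) : hatDist K x p ≤ 1 := by
  by_cases h1 : dist x p ≤ 1
  · exact (hatDist_le_dist x p).trans h1
  push Not at h1
  rcases h with h | h | h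
  · exact (hatDist_le_dist x p).trans (hp.dist_le_left.trans h)
  · refine (h.mono hX ?_ h1.le).hatDist_le
    unfold Btw at hp
    simpa using hp
  · rw [hatDist_comm]
    refine (h.mono hX (a := p) (b := x) ?_ (by rw [dist_comm]; exact h1.le)).hatDist_le
    have := hp.symm
    unfold Btw at this
    simpa using this

variable (K) in
/-- The points `c 0, …, c n` are consecutively adjacent. -/
def IsChain (n : ℕ) (c : ℕ → X) : Prop := ∀ i < n, Adj K (c i) (c (i + 1))

theorem IsChain.shift {n : ℕ} {c : ℕ → X} (h : IsChain K n c) (i m : ℕ) (him : i + m ≤ n) :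
    IsChain K m (fun j => c (i + j)) := fun j hj => h (i + j) (by omega)

/-- The weight of a step of a chain. -/
noncomputable def stepWeight (c : ℕ → X) (i : ℕ) : ℝ := min (dist (c i) (c (i + 1))) 1

theorem stepWeight_nonneg (c : ℕ → X) (i : ℕ) : 0 ≤ stepWeight c i :=
  le_min dist_nonneg zero_le_one

variable (K) in
/-- The total weights of the chains from `x` to `y`. -/
def chainLengths (x y : X) : Set ℝ :=
  {ℓ | ∃ (n : ℕ) (c : ℕ → X), c 0 = x ∧ c n = y ∧ IsChain K n c ∧
    ∑ i ∈ Finset.range n, stepWeight c i = ℓ}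

theorem bddBelow_chainLengths (x y : X) : BddBelow (chainLengths K x y) :=
  ⟨0, by
    rintro ℓ ⟨n, c, -, -, -, rfl⟩
    exact Finset.sum_nonneg fun i _ => stepWeight_nonneg c i⟩

theorem chainLengths_cons {x x' y : X} {ℓ : ℝ} (h : Adj K x x') (hℓ : ℓ ∈ chainLengths K x' y) :
    min (dist x x') 1 + ℓ ∈ chainLengths K x y := by
  obtain ⟨n, c, h0, hn, hc, rfl⟩ := hℓ
  refine ⟨n + 1, fun i => Nat.casesOn i x c, rfl, hn, ?_, ?_⟩
  · rintro (_ | i) hi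
    · change Adj K x (c 0)
      rwa [h0]
    · exact hc i (by omega)
  · rw [Finset.sum_range_succ', add_comm]
    congr 1
    change min (dist x (c 0)) 1 = _
    rw [h0]

/-- A geodesic of `X` is cut into unit steps, at most `N` of them, since a step of a chain has
length at most one unless it joins an anti-contracting pair. -/
theorem chainLengths_dist (hX : IsGeodesicSpace X) (N : ℕ) : ∀ {x x' y : X} {ℓ : ℝ},
    dist x x' ≤ N → ℓ ∈ chainLengths K x' y → dist x x' + ℓ ∈ chainLengths K x y := by
  induction N with
  | zero =>
    intro x x' y ℓ h hℓ
    have : x = x' := dist_le_zero.1 (by simpa using h)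
    subst this
    simpa using hℓ
  | succ N ih =>
    intro x x' y ℓ h hℓ
    by_cases h1 : dist x x' ≤ 1
    · have := chainLengths_cons (Or.inl h1) hℓ
      rwa [min_eq_left h1] at this
    · push Not at h1
      obtain ⟨γ, rfl, rfl⟩ := hX x x'
      rw [← γ.len_eq] at *
      have e1 := γ.dist_toFun γ.zero_mem ⟨zero_le_one, h1.le⟩ zero_le_one
      have e2 := γ.dist_toFun ⟨zero_le_one, h1.le⟩ γ.len_mem h1.le
      push_cast at h
      have := chainLengths_cons (K := K) (x := γ.source) (x' := γ.toFun 1)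
        (Or.inl (by unfold source; linarith))
        (ih (x' := γ.target) (by unfold target; linarith) hℓ)
      unfold source target at this
      unfold source
      rw [e1, e2, min_eq_right (by simp)] at this
      convert this using 1
      ring

theorem chainLengths_nonempty (hX : IsGeodesicSpace X) (x y : X) :
    (chainLengths K x y).Nonempty := by
  obtain ⟨N, hN⟩ := exists_nat_ge (dist x y)
  exact ⟨_, chainLengths_dist hX N hN ⟨0, fun _ => y, rfl, rfl, fun i hi => by omega, rfl⟩⟩

/-- The infimum of chain weights to `y` is a 1-Lipschitz function of the starting point and varies
by at most one along anti-contracting pairs. So `abs_sub_le_hatDist` bounds it by `hatDist`. -/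
theorem exists_chain_length_le (hX : IsGeodesicSpace X) (x y : X) :
    ∃ (n : ℕ) (c : ℕ → X), c 0 = x ∧ c n = y ∧ IsChain K n c ∧
      ∑ i ∈ Finset.range n, stepWeight c i ≤ hatDist K x y + 1 := by
  let f : X → ℝ := fun x => sInf (chainLengths K x y)
  have step : ∀ x x' a, (∀ ℓ ∈ chainLengths K x' y, a + ℓ ∈ chainLengths K x y) →
      f x - f x' ≤ a := by
    intro x x' a h
    have : f x - a ≤ f x' := by
      refine le_csInf (chainLengths_nonempty hX x' y) fun ℓ hℓ => ?_
      have := csInf_le (bddBelow_chainLengths x y) (h ℓ hℓ)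
      change f x ≤ a + ℓ at this
      linarith
    linarith
  have h1 : ∀ x x', f x - f x' ≤ dist x x' := fun x x' => by
    obtain ⟨N, hN⟩ := exists_nat_ge (dist x x')
    exact step _ _ _ fun ℓ hℓ => chainLengths_dist hX N hN hℓ
  have h2 : ∀ x x', Adj K x x' → f x - f x' ≤ 1 := fun x x' h =>
    (step _ _ _ fun ℓ hℓ => chainLengths_cons h hℓ).trans (min_le_right _ _)
  have key := abs_sub_le_hatDist (K := K) (f := f)
    (fun x x' => abs_sub_le_iff.2 ⟨h1 x x', dist_comm x x' ▸ h1 x' x⟩)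
    (fun x x' h => abs_sub_le_iff.2 ⟨h2 _ _ (Or.inr (Or.inl h)), h2 _ _ (Or.inr (Or.inr h))⟩) x y
  have hy : f y ≤ 0 := csInf_le (bddBelow_chainLengths y y)
    ⟨0, fun _ => y, rfl, rfl, fun i hi => by omega, rfl⟩
  have hlt : f x < hatDist K x y + 1 := by linarith [le_abs_self (f x - f y)]
  obtain ⟨ℓ, ⟨n, c, h0, hn, hc, rfl⟩, hℓ⟩ :=
    exists_lt_of_csInf_lt (chainLengths_nonempty hX x y) hlt
  exact ⟨n, c, h0, hn, hc, hℓ.le⟩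

/-- Two consecutive short steps of a chain can be merged. -/
theorem IsChain.exists_merge {n : ℕ} {c : ℕ → X} (hc : IsChain K n c) {i : ℕ} (hi : i + 1 < n)
    (h : stepWeight c i + stepWeight c (i + 1) < 1) :
    ∃ c' : ℕ → X, c' 0 = c 0 ∧ c' (n - 1) = c n ∧ IsChain K (n - 1) c' ∧
      ∑ j ∈ Finset.range (n - 1), stepWeight c' j ≤ ∑ j ∈ Finset.range n, stepWeight c j := by
  obtain ⟨k, rfl⟩ : ∃ k, n = i + (1 + (1 + k)) := ⟨n - i - 2, by omega⟩
  have e : i + (1 + (1 + k)) - 1 = i + (1 + k) := by omega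
  rw [e]
  -- With total weight below one neither minimum is attained at `1`, so both weights are distances
  -- in `X` and the middle point can be dropped.
  have hw : dist (c i) (c (i + 2)) ≤ stepWeight c i + stepWeight c (i + 1) := by
    have p1 := stepWeight_nonneg c i
    have p2 := stepWeight_nonneg c (i + 1)
    unfold stepWeight at *
    have q1 : min (dist (c i) (c (i + 1))) 1 = dist (c i) (c (i + 1)) :=
      min_eq_left (by by_contra hh; rw [min_eq_right (by linarith)] at h; linarith)
    have q2 : min (dist (c (i + 1)) (c (i + 1 + 1))) 1 = dist (c (i + 1)) (c (i + 1 + 1)) :=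
      min_eq_left (by
        by_contra hh
        rw [min_eq_right (a := dist (c (i + 1)) (c (i + 1 + 1))) (by linarith)] at h
        linarith)
    rw [q1, q2]
    exact dist_triangle _ _ _
  let c' : ℕ → X := fun j => if j ≤ i then c j else c (j + 1)
  have c1 : ∀ j ≤ i, c' j = c j := fun j hj => if_pos hj
  have c2 : ∀ j, i < j → c' j = c (j + 1) := fun j hj => if_neg (by omega)
  refine ⟨c', c1 0 (by omega), ?_, ?_, ?_⟩
  · rw [c2 _ (by omega)]
    congr 1
    omega
  · intro j hj
    rcases lt_trichotomy j i with h' | h' | h'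
    · rw [c1 j h'.le, c1 (j + 1) h']
      exact hc j (by omega)
    · subst h'
      rw [c1 j le_rfl, c2 (j + 1) (by omega)]
      exact Or.inl (hw.trans h.le)
    · rw [c2 j h', c2 (j + 1) (by omega)]
      exact hc (j + 1) (by omega)
  · have s0 : ∑ x ∈ Finset.range (1 + k), stepWeight c (i + (1 + x)) =
        stepWeight c (i + 1) + ∑ x ∈ Finset.range k, stepWeight c (i + (1 + (1 + x))) := by
      rw [Finset.sum_range_add]
      simp
    rw [Finset.sum_range_add, Finset.sum_range_add, Finset.sum_range_add, Finset.sum_range_add]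
    simp only [Finset.range_one, Finset.sum_singleton, add_zero]
    have s1 : ∑ x ∈ Finset.range i, stepWeight c' x = ∑ x ∈ Finset.range i, stepWeight c x := by
      refine Finset.sum_congr rfl fun j hj => ?_
      rw [Finset.mem_range] at hj
      unfold stepWeight
      rw [c1 j hj.le, c1 (j + 1) hj]
    have s2 : ∑ x ∈ Finset.range k, stepWeight c' (i + (1 + x)) =
        ∑ x ∈ Finset.range k, stepWeight c (i + (1 + (1 + x))) := by
      refine Finset.sum_congr rfl fun j hj => ?_
      unfold stepWeight
      rw [c2 _ (by omega), c2 _ (by omega)]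
      congr 3
      · omega
      · omega
    have s3 : stepWeight c' i ≤ dist (c i) (c (i + 2)) := by
      unfold stepWeight
      rw [c1 i le_rfl, c2 (i + 1) (by omega)]
      exact min_le_left _ _
    rw [s1, s2]
    rw [s0]
    linarith

theorem natCast_le_two_mul_sum {f : ℕ → ℝ} {n : ℕ} (h0 : ∀ i, 0 ≤ f i)
    (h : ∀ i, i + 1 < n → 1 ≤ f i + f (i + 1)) {i : ℕ} : ∀ m, i + m ≤ n →
    (m : ℝ) ≤ 2 * ∑ j ∈ Finset.Ico i (i + m), f j + 1 := by
  intro m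
  induction m using Nat.twoStepInduction with
  | zero => simp
  | one =>
    intro _
    have := Finset.sum_nonneg (s := Finset.Ico i (i + 1)) fun j _ => h0 j
    push_cast
    linarith
  | more m ih _ =>
    intro hm
    have e := ih (by omega)
    rw [show i + (m + 2) = i + m + 1 + 1 by omega, Finset.sum_Ico_succ_top (by omega),
      Finset.sum_Ico_succ_top (by omega)]
    have := h (i + m) (by omega)
    push_cast
    linarith

/-- A chain that is quasi-geodesic, and geodesic up to an additive error, in the contraction
space. -/
structure IsGoodChain (K : ℝ≥0 → ℝ≥0∞) (n : ℕ) (c : ℕ → X) : Prop where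
  isChain : IsChain K n c
  le_hatDist : ∀ i j, i ≤ j → j ≤ n → (j : ℝ) - i ≤ 2 * hatDist K (c i) (c j) + 3
  hatDist_add_le : ∀ i ≤ n, hatDist K (c 0) (c i) + hatDist K (c i) (c n) ≤
    hatDist K (c 0) (c n) + 1

/-- Among the chains of weight at most `hatDist + 1`, take one with fewest steps. No two consecutive
steps can be merged, so they weigh at least one together and weight controls the number of steps.
The excess over `hatDist` is at most one in total, hence also on every subchain. -/
theorem exists_isGoodChain (hX : IsGeodesicSpace X) (x y : X) :
    ∃ (n : ℕ) (c : ℕ → X), c 0 = x ∧ c n = y ∧ IsGoodChain K n c := by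
  classical
  have hex := exists_chain_length_le (K := K) hX x y
  obtain ⟨c, h0, hn, hc, hℓ⟩ := Nat.find_spec hex
  have hmin := fun m hm => Nat.find_min hex (m := m) hm
  set n := Nat.find hex with hndef
  clear_value n
  have hsum : ∀ i, i + 1 < n → 1 ≤ stepWeight c i + stepWeight c (i + 1) := by
    intro i hi
    by_contra hlt
    push Not at hlt
    obtain ⟨c', h0', hn', hc', hℓ'⟩ := hc.exists_merge hi hlt
    exact hmin (n - 1) (by omega) ⟨c', h0'.trans h0, hn'.trans hn, hc', hℓ'.trans hℓ⟩
  have hdist : ∀ i j, i ≤ j → j ≤ n →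
      hatDist K (c i) (c j) ≤ ∑ l ∈ Finset.Ico i j, stepWeight c l := by
    intro i j hij hj
    exact dist_le_Ico_sum_of_dist_le
      (f := fun l => (ContractionSpace.incl (c l) : ContractionSpace X K)) hij
      fun {l} _ hl => (hc l (by omega)).hatDist_le
  have hsplit : ∀ i j, i ≤ j → j ≤ n → ∑ l ∈ Finset.Ico 0 i, stepWeight c l +
      ∑ l ∈ Finset.Ico i j, stepWeight c l + ∑ l ∈ Finset.Ico j n, stepWeight c l ≤
      hatDist K (c 0) (c n) + 1 := by
    intro i j hij hj
    rw [Finset.sum_Ico_consecutive _ (Nat.zero_le _) hij,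
      Finset.sum_Ico_consecutive _ (Nat.zero_le _) hj, ← Finset.range_eq_Ico, h0, hn]
    exact hℓ
  refine ⟨n, c, h0, hn, hc, fun i j hij hj => ?_, fun i hi => ?_⟩
  · obtain ⟨m, rfl⟩ := Nat.exists_eq_add_of_le hij
    have e := natCast_le_two_mul_sum (stepWeight_nonneg c) hsum m hj
    have e1 := hsplit _ _ hij hj
    have e2 := hdist 0 i (Nat.zero_le _) (by omega)
    have e3 := hdist (i + m) n hj le_rfl
    have e4 := hatDist_triangle (K := K) (c 0) (c i) (c n)
    have e5 := hatDist_triangle (K := K) (c i) (c (i + m)) (c n)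
    push_cast
    linarith
  · have e1 := hsplit i i le_rfl hi
    have e2 := hdist 0 i (Nat.zero_le _) hi
    have e3 := hdist i n hi le_rfl
    simp only [Finset.Ico_self, Finset.sum_empty] at e1
    linarith

/-! ### Geodesics of `X` are close to geodesics of the contraction space -/

/-- The logarithmic estimate: halve the chain, pass at cost one from the geodesic to one of the
geodesics spanned by the halves, and iterate. -/
theorem exists_near_chain_zero (hX : IsGeodesicSpace X) (hK : IsContractionGauge K) (k : ℕ) :
    ∀ {n : ℕ} {c : ℕ → X} {p : X}, IsChain K n c → n ≤ 2 ^ k → Btw (c 0) p (c n) →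
      ∃ i ≤ n, hatDist K p (c i) ≤ k + 1 := by
  induction k with
  | zero =>
    intro n c p hc hn hp
    refine ⟨0, by omega, ?_⟩
    have hadj : Adj K (c 0) (c n) := by
      rcases (by omega : n = 0 ∨ n = 1) with rfl | rfl
      · exact Or.inl (by simp)
      · exact hc 0 one_pos
    rw [hatDist_comm]
    simpa using hadj.hatDist_btw_le hX hp
  | succ k ih =>
    intro n c p hc hn hp
    rw [pow_succ] at hn
    obtain ⟨q, hq, hpq⟩ := exists_hatDist_le_one hX hK hp (c (n / 2))
    push_cast
    rcases hq with hq | hq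
    · obtain ⟨i, hi, hd⟩ := ih (n := n / 2) (c := c) (fun i hi => hc i (by omega)) (by omega) hq
      exact ⟨i, by omega, by linarith [hatDist_triangle (K := K) p q (c i)]⟩
    · obtain ⟨i, hi, hd⟩ := ih (n := n - n / 2) (hc.shift (n / 2) (n - n / 2) (by omega))
        (p := q) (by omega) (by
          rw [add_zero, show n / 2 + (n - n / 2) = n by omega]
          exact hq)
      exact ⟨n / 2 + i, by omega, by linarith [hatDist_triangle (K := K) p q (c (n / 2 + i))]⟩

theorem exists_near_chain (hX : IsGeodesicSpace X) (hK : IsContractionGauge K) {k n : ℕ}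
    {c : ℕ → X} {p : X} (hc : IsChain K n c) {i j : ℕ} (hi : i ≤ n) (hj : j ≤ n)
    (hij : i ≤ j + 2 ^ k) (hji : j ≤ i + 2 ^ k) (hp : Btw (c i) p (c j)) :
    ∃ l ≤ n, hatDist K p (c l) ≤ k + 1 := by
  have main : ∀ i j, i ≤ j → j ≤ n → j ≤ i + 2 ^ k → Btw (c i) p (c j) →
      ∃ l ≤ n, hatDist K p (c l) ≤ k + 1 := by
    intro i j hij hj hle hp
    obtain ⟨m, rfl⟩ := Nat.exists_eq_add_of_le hij
    obtain ⟨l, hl, hd⟩ := exists_near_chain_zero hX hK k (hc.shift i m hj) (by omega) hp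
    exact ⟨i + l, by omega, hd⟩
  rcases le_total i j with h | h
  · exact main i j h hj hji hp
  · exact main j i h hi hij hp.symm

theorem exists_near_of_hatDist_le (hX : IsGeodesicSpace X) (hK : IsContractionGauge K) {k : ℕ}
    {a b q : X} {t : ℝ} (hab : hatDist K a b ≤ t) (hk : 2 * t + 3 ≤ 2 ^ k) (hq : Btw a q b) :
    ∃ e, hatDist K q e ≤ k + 1 ∧ hatDist K a e ≤ t + 1 := by
  obtain ⟨n, c, rfl, rfl, hc⟩ := exists_isGoodChain (K := K) hX a b
  have hn : (n : ℝ) ≤ 2 ^ k := by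
    have := hc.le_hatDist 0 n (Nat.zero_le _) le_rfl
    simp only [Nat.cast_zero, sub_zero] at this
    linarith
  obtain ⟨i, hi, hd⟩ := exists_near_chain_zero hX hK k hc.isChain (by exact_mod_cast hn) hq
  refine ⟨c i, hd, ?_⟩
  linarith [hc.hatDist_add_le i hi, hatDist_nonneg (K := K) (c i) (c n)]

theorem continuous_incl : Continuous (ContractionSpace.incl : X → ContractionSpace X K) := by
  refine LipschitzWith.continuous (K := 1) (LipschitzWith.of_dist_le_mul fun y z => ?_)
  rw [NNReal.coe_one, one_mul]
  exact hatDist_le_dist (K := K) y z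

/-- For the Morse argument with `t` the maximal `hatDist` to the chain: walk away from `m` until
`hatDist` equals `2t`, or to the end of the segment, which is on the chain, if its `hatDist` from
`m` is at most `2t`. Either way a jump of at most `t` leads to the chain. -/
theorem exists_escape_point {n : ℕ} {c : ℕ → X} {m : X} {t : ℝ} (ht : 0 ≤ t)
    (δ : GeodesicSegment X) (hs : δ.source = m) {i₀ : ℕ} (hi₀ : i₀ ≤ n) (hδ : δ.target = c i₀)
    (h : ∀ q ∈ δ.image, ∃ i ≤ n, hatDist K q (c i) ≤ t) :
    ∃ q, Btw m q (c i₀) ∧ ∃ i ≤ n, hatDist K q (c i) ≤ t ∧ hatDist K m q ≤ 2 * t ∧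
      (2 * t ≤ hatDist K m q ∨ q = c i) := by
  by_cases hle : hatDist K m (c i₀) ≤ 2 * t
  · exact ⟨c i₀, btw_right _ _, i₀, hi₀, by rw [hatDist_self]; exact ht, hle, Or.inr rfl⟩
  push Not at hle
  have hcont : ContinuousOn (fun s => hatDist K m (δ.toFun s)) (Set.Icc 0 δ.len) :=
    (continuous_hatDist m).comp_continuousOn δ.continuousOn
  obtain ⟨s, hsm, hst⟩ := intermediate_value_Icc δ.len_nonneg hcont (show 2 * t ∈ _ from
    ⟨by
      change hatDist K m δ.source ≤ _
      rw [hs, hatDist_self]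
      linarith, by
      change _ ≤ hatDist K m δ.target
      rw [hδ]
      exact hle.le⟩)
  obtain ⟨i, hi, hd⟩ := h _ ⟨s, hsm, rfl⟩
  exact ⟨δ.toFun s, hs ▸ hδ ▸ δ.btw_of_mem ⟨s, hsm, rfl⟩, i, hi, hd, le_of_eq hst,
    Or.inl (ge_of_eq hst)⟩

/-- Exponentials beat linear functions: for `t > 20` the exponent `k = ⌊t⌋ - 5` meets the premise
and violates the conclusion. -/
theorem le_of_forall_two_pow {t : ℝ} (h : ∀ k : ℕ, 12 * t + 3 ≤ 2 ^ k → t ≤ k + 4) : t ≤ 20 := by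
  by_contra hlt
  push Not at hlt
  have pw : ∀ j : ℕ, 12 * ((j + 15 : ℕ) + 6 : ℝ) + 3 ≤ 2 ^ (j + 15) := by
    intro j
    induction j with
    | zero => norm_num
    | succ j ih =>
      rw [show j + 1 + 15 = (j + 15) + 1 by omega, pow_succ]
      push_cast at *
      linarith
  have hfl := Nat.floor_le (show 0 ≤ t by linarith)
  have hfl' := Nat.lt_floor_add_one t
  have h20 : 20 ≤ ⌊t⌋₊ := Nat.le_floor (by exact_mod_cast hlt.le)
  obtain ⟨j, hj⟩ := Nat.exists_eq_add_of_le h20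
  rw [hj] at hfl hfl'
  push_cast at hfl hfl'
  have e := pw j
  have := h (j + 15) (by push_cast at e; linarith)
  push_cast at this
  linarith

/-- Let `m` be the point of the geodesic farthest from the chain, at distance `F m`. Escape on both
sides to `a` and `b`, which are `F m`-close to `c i` and `c j`. Thin triangles put `m` within 2 of a
point of `[a, c i]`, `[c i, c j]` or `[c j, b]`. The outer sides are too short to return to `m`, and
the middle one is logarithmically close to the chain. Thus `F m` is at most logarithmic in itself.
-/
theorem IsGoodChain.exists_near (hX : IsGeodesicSpace X) (hK : IsContractionGauge K) {n : ℕ}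
    {c : ℕ → X} (hc : IsGoodChain K n c) {p : X} (hp : Btw (c 0) p (c n)) :
    ∃ i ≤ n, hatDist K p (c i) ≤ 20 := by
  obtain ⟨γ, hγs, hγt, hγp⟩ := hX.exists_through hp
  let S : Set (ContractionSpace X K) := (fun i => .incl (c i)) '' Set.Iic n
  have hS : IsCompact S := ((Set.finite_Iic n).image _).isCompact
  have hSne : S.Nonempty := ⟨_, 0, Nat.zero_le n, rfl⟩
  let F : X → ℝ := fun q => Metric.infDist (.incl q : ContractionSpace X K) S
  have hF : Continuous F := (Metric.continuous_infDist_pt S).comp continuous_incl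
  have hFle : ∀ q, ∀ i ≤ n, F q ≤ hatDist K q (c i) := fun q i hi =>
    Metric.infDist_le_dist_of_mem ⟨i, hi, rfl⟩
  have hFex : ∀ q, ∃ i ≤ n, hatDist K q (c i) = F q := by
    intro q
    obtain ⟨_, ⟨i, hi, rfl⟩, h⟩ := hS.exists_infDist_eq_dist hSne (.incl q)
    exact ⟨i, hi, h.symm⟩
  obtain ⟨m, hm, hmax⟩ := γ.isCompact_image.exists_isMaxOn ⟨_, hγp⟩ hF.continuousOn
  have ht0 : 0 ≤ F m := Metric.infDist_nonneg
  suffices hmain : F m ≤ 20 by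
    obtain ⟨i, hi, h⟩ := hFex p
    exact ⟨i, hi, h.le.trans ((hmax hγp).trans hmain)⟩
  refine le_of_forall_two_pow fun k hk => ?_
  have hnear : ∀ q ∈ γ.image, ∃ i ≤ n, hatDist K q (c i) ≤ F m := by
    intro q hq
    obtain ⟨i, hi, h⟩ := hFex q
    exact ⟨i, hi, h.le.trans (hmax hq)⟩
  obtain ⟨δ₁, h1s, h1t, h1⟩ := γ.exists_to_source hm
  obtain ⟨δ₂, h2s, h2t, h2⟩ := γ.exists_to_target hm
  obtain ⟨a, ha, i, hi, hai, hma, ha'⟩ := exists_escape_point ht0 δ₁ h1s (Nat.zero_le n)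
    (h1t.trans hγs) fun q hq => hnear q (h1 hq)
  obtain ⟨b, hb, j, hj, hbj, hmb, hb'⟩ := exists_escape_point ht0 δ₂ h2s le_rfl
    (h2t.trans hγt) fun q hq => hnear q (h2 hq)
  have hmxy : Btw (c 0) m (c n) := hγs ▸ hγt ▸ γ.btw_of_mem hm
  have hamb : Btw a m b := ((hmxy.mid ha.symm).symm.mid hb.symm).symm
  have hend : ∀ (a : X) (i : ℕ), i ≤ n → hatDist K a (c i) ≤ F m →
      (2 * F m ≤ hatDist K m a ∨ a = c i) → ∀ q, Btw a q (c i) → hatDist K m q ≤ 2 →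
      F m ≤ k + 4 := by
    intro a i hi hai ha' q hq hmq
    rcases ha' with ha' | rfl
    · obtain ⟨e, he, hae⟩ := exists_near_of_hatDist_le hX hK hai (by linarith) hq
      have t1 := hatDist_triangle (K := K) m e a
      have t2 := hatDist_triangle (K := K) m q e
      rw [hatDist_comm e a] at t1
      linarith
    · have hq' : dist (c i) q = 0 := by
        unfold Btw at hq
        rw [dist_self] at hq
        linarith [dist_nonneg (x := c i) (y := q), dist_nonneg (x := q) (y := c i)]
      have := hFle m i hi
      rw [dist_eq_zero.1 hq'] at this
      linarith [(Nat.cast_nonneg k : (0 : ℝ) ≤ k)]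
  obtain ⟨q, hq, hmq⟩ := exists_hatDist_le_one hX hK hamb (c i)
  rcases hq with hq | hq
  · exact hend a i hi hai ha' q hq (by linarith)
  obtain ⟨q', hq', hqq'⟩ := exists_hatDist_le_one hX hK hq (c j)
  have hmq' : hatDist K m q' ≤ 2 := by linarith [hatDist_triangle (K := K) m q q']
  rcases hq' with hq' | hq'
  -- The route `c i`, `a`, `m`, `b`, `c j` costs `1 + 2 + 2 + 1` times `F m`; doubling it, as in
  -- `le_hatDist`, gives the `12` of `le_of_forall_two_pow`.
  · have hcc : hatDist K (c i) (c j) ≤ 6 * F m := by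
      have t1 := hatDist_triangle (K := K) (c i) a (c j)
      have t2 := hatDist_triangle (K := K) a m (c j)
      have t3 := hatDist_triangle (K := K) m b (c j)
      rw [hatDist_comm (c i) a] at t1
      rw [hatDist_comm a m] at t2
      linarith
    have bound : ∀ i j : ℕ, j ≤ n → hatDist K (c i) (c j) ≤ 6 * F m → j ≤ i + 2 ^ k := by
      intro i j hj hij
      rcases le_total j i with h | h
      · exact h.trans (Nat.le_add_right _ _)
      · have e := hc.le_hatDist i j h hj
        have : (j : ℝ) ≤ i + 2 ^ k := by linarith
        exact_mod_cast this
    obtain ⟨l, hl, hd⟩ := exists_near_chain hX hK hc.isChain hi hj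
      (bound j i hi (by rw [hatDist_comm]; exact hcc)) (bound i j hj hcc) hq'
    have := hFle m l hl
    linarith [hatDist_triangle (K := K) m q' (c l)]
  · exact hend b j hj hbj hb' q' hq'.symm hmq'

/-- Geodesics of `X` do not backtrack in the contraction space. -/
theorem hatDist_add_le (hX : IsGeodesicSpace X) (hK : IsContractionGauge K) {x p y : X}
    (hp : Btw x p y) : hatDist K x p + hatDist K p y ≤ hatDist K x y + 41 := by
  obtain ⟨n, c, rfl, rfl, hc⟩ := exists_isGoodChain (K := K) hX x y
  obtain ⟨i, hi, hd⟩ := hc.exists_near hX hK hp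
  have h1 := hc.hatDist_add_le i hi
  have t1 := hatDist_triangle (K := K) (c 0) (c i) p
  have t2 := hatDist_triangle (K := K) p (c i) (c n)
  rw [hatDist_comm (c i) p] at t1
  linarith

/-! ### Hyperbolicity -/

/-- The centre `p` of the triangle `x, y, w` has, coarsely, `hatDist p w` equal to the Gromov
product of `x` and `y` at `w`. It is close to `[x, z]` or to `[z, y]`, which bounds the
corresponding Gromov product with `z` by `hatDist p w`. -/
theorem hatDist_four_point (hX : IsGeodesicSpace X) (hK : IsContractionGauge K) (x y z w : X) :
    hatDist K x y + hatDist K z w ≤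
      max (hatDist K x z + hatDist K y w) (hatDist K x w + hatDist K y z) + 2 * 66 := by
  obtain ⟨p, u, v, hp, hu, hv, hpu, hpv⟩ := exists_centre hX hK x y w
  have a1 := hatDist_add_le hX hK hu
  have a2 := hatDist_add_le hX hK hv
  have b1 := hatDist_triangle (K := K) x u p
  have b2 := hatDist_triangle (K := K) p u w
  have b3 := hatDist_triangle (K := K) w v p
  have b4 := hatDist_triangle (K := K) p v y
  have b5 := hatDist_triangle (K := K) x p y
  rw [hatDist_comm u p] at b1
  rw [hatDist_comm v p] at b3
  rw [hatDist_comm w p] at b3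
  have hside : ∀ x q z, Btw x q z → hatDist K p q ≤ 1 →
      hatDist K x w + hatDist K z w ≤ hatDist K x z + 43 + 2 * hatDist K p w := by
    intro x q z hq hpq
    have a := hatDist_add_le hX hK hq
    have c1 := hatDist_triangle (K := K) x q w
    have c2 := hatDist_triangle (K := K) z q w
    have c3 := hatDist_triangle (K := K) q p w
    rw [hatDist_comm q p] at c3
    rw [hatDist_comm z q] at c2
    linarith
  obtain ⟨q, hq, hpq⟩ := exists_hatDist_le_one hX hK hp z
  rcases hq with hq | hq
  · have := hside x q z hq hpq
    have := le_max_left (hatDist K x z + hatDist K y w) (hatDist K x w + hatDist K y z)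
    rw [hatDist_comm w y] at a2
    linarith
  · have := hside z q y hq hpq
    have := le_max_right (hatDist K x z + hatDist K y w) (hatDist K x w + hatDist K y z)
    rw [hatDist_comm w y] at a2
    rw [hatDist_comm z y] at *
    linarith

theorem exists_dist_incl_le (z : ContractionSpace X K) :
    ∃ x : X, dist z (.incl x) ≤ 1 := by
  cases z with
  | incl x => exact ⟨x, by simp⟩
  | inner p t =>
    refine ⟨p.1.1, ?_⟩
    have hst := ContractionSpace.IsStep.along p t 0 ⟨t.2.1.le, t.2.2.le⟩ (by simp)
    rw [ContractionSpace.edge_zero, ContractionSpace.edge_of_mem] at hst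
    refine (csInf_le (ContractionSpace.bddBelow_pathLengths _ _) hst.isPathLength).trans ?_
    rw [sub_zero, abs_of_pos t.2.1]
    exact t.2.2.le

theorem abs_dist_sub_hatDist_le {z w : ContractionSpace X K} {x y : X}
    (hx : dist z (.incl x) ≤ 1) (hy : dist w (.incl y) ≤ 1) :
    |dist z w - hatDist K x y| ≤ 2 := by
  have h1 := dist_triangle4 z (.incl x) (.incl y) w
  have h2 := dist_triangle4 (.incl x) z w (.incl y)
  rw [dist_comm (.incl y) w] at h1
  rw [dist_comm (.incl x) z] at h2
  rw [abs_le]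
  unfold hatDist
  constructor <;> linarith

theorem isGromovHyperbolic_contractionSpace (hX : IsGeodesicSpace X)
    (hK : IsContractionGauge K) : IsGromovHyperbolic (ContractionSpace X K) := by
  refine ⟨70, fun z₁ z₂ z₃ z₄ => ?_⟩
  obtain ⟨x₁, h1⟩ := exists_dist_incl_le z₁
  obtain ⟨x₂, h2⟩ := exists_dist_incl_le z₂
  obtain ⟨x₃, h3⟩ := exists_dist_incl_le z₃
  obtain ⟨x₄, h4⟩ := exists_dist_incl_le z₄
  have key := hatDist_four_point hX hK x₁ x₂ x₃ x₄
  have e12 := abs_le.1 (abs_dist_sub_hatDist_le h1 h2)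
  have e34 := abs_le.1 (abs_dist_sub_hatDist_le h3 h4)
  have e13 := abs_le.1 (abs_dist_sub_hatDist_le h1 h3)
  have e24 := abs_le.1 (abs_dist_sub_hatDist_le h2 h4)
  have e14 := abs_le.1 (abs_dist_sub_hatDist_le h1 h4)
  have e23 := abs_le.1 (abs_dist_sub_hatDist_le h2 h3)
  have m1 := le_max_left (dist z₁ z₃ + dist z₂ z₄) (dist z₁ z₄ + dist z₂ z₃)
  have m2 := le_max_right (dist z₁ z₃ + dist z₂ z₄) (dist z₁ z₄ + dist z₂ z₃)
  rcases max_choice (hatDist K x₁ x₃ + hatDist K x₂ x₄) (hatDist K x₁ x₄ + hatDist K x₂ x₃)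
    with h | h <;> rw [h] at key <;> linarith

end Hyperbolicity

/-! ### Bottlenecks on long geodesics and non-uniform acylindricity -/

section Acylindricity

variable {X : Type u} [MetricSpace X] {K : ℝ≥0 → ℝ≥0∞}

open GeodesicSegment

/-- If `m` is close in `X` to a point `w` and separated by a bottleneck from `x`, then that
bottleneck is not far from `x` in the contraction space unless `w` is. -/
theorem IsBottleneck.hatDist_le (hX : IsGeodesicSpace X) (hK : IsContractionGauge K)
    {x a b m₁ m₂ w : X} {r₁ r₂ : ℝ} (h : IsBottleneck a b m₁ r₁)
    (hxm : dist x a + dist a b + dist b m₂ = dist x m₂)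
    (hw : dist w m₂ ≤ r₂) (hbm : 4 * r₂ + 1 ≤ 2 * dist b m₂) :
    hatDist K x m₁ ≤ hatDist K x w + 42 := by
  obtain ⟨β₂, h2s, h2t⟩ := hX m₂ w
  obtain ⟨β₁, h1s, h1t⟩ := hX w x
  obtain ⟨p, hp, hpm⟩ := h.meets x m₂ hxm β₂ β₁ (const x) h2s (h2t.trans h1s.symm) h1t rfl
  have hp' : p ∈ β₂.image ∪ β₁.image := by
    rcases hp with hp | hp
    · exact hp
    · rw [image_const] at hp
      rw [Set.mem_singleton_iff.1 hp, ← h1t]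
      exact Or.inr β₁.target_mem
  obtain ⟨q, hq, hmin⟩ := (β₂.isCompact_image.union β₁.isCompact_image).exists_isMinOn
    ⟨p, hp'⟩ (f := fun q => dist m₁ q) (by fun_prop)
  have hb := h.btw
  have hl := h.left
  have hr := h.right
  have h0 := h.nonneg
  have hbtw : dist x m₁ + dist m₁ m₂ = dist x m₂ ∧ dist m₁ m₂ = dist m₁ b + dist b m₂ := by
    unfold Btw at hb
    have t1 := dist_triangle x a m₁
    have t2 := dist_triangle m₁ b m₂
    have t3 := dist_triangle x m₁ m₂
    constructor <;> linarith
  have hxmm : Btw m₂ m₁ x := Btw.symm hbtw.1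
  have hq1 := hatDist_closest_le hX hK hxmm β₂ β₁ h2s (h2t.trans h1s.symm) h1t hq hmin
  have hmq : dist m₁ q ≤ r₁ := (hmin hp').trans ((dist_comm m₁ p).le.trans hpm)
  -- The side `[m₂, w]` has length at most `r₂`, while `d(m₁, m₂)` is at least `2 r₁ + 2 r₂ + 1`, so
  -- it cannot come `r₁`-close to `m₁`. On `[w, x]` non-backtracking applies.
  rcases hq with hq | hq
  · exfalso
    have e : Btw m₂ q w := h2s ▸ h2t ▸ β₂.btw_of_mem hq
    have e' := e.dist_le_left
    have t := dist_triangle m₁ q m₂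
    rw [dist_comm q m₂] at t
    rw [dist_comm m₂ w] at e'
    linarith [hbtw.2, dist_nonneg (x := m₂) (y := q)]
  · have e : Btw w q x := h1s ▸ h1t ▸ β₁.btw_of_mem hq
    have e1 := hatDist_add_le hX hK e
    have t := hatDist_triangle (K := K) x q m₁
    rw [hatDist_comm q m₁, hatDist_comm x q] at t
    rw [hatDist_comm x w]
    linarith [hatDist_nonneg (K := K) w q]

theorem exists_hatDist_eq {γ : GeodesicSegment X} {s T : ℝ} (hs : s ∈ Set.Icc 0 γ.len)
    (h1 : hatDist K γ.source (γ.toFun s) ≤ T) (h2 : T ≤ hatDist K γ.source γ.target) :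
    ∃ t ∈ Set.Icc s γ.len, hatDist K γ.source (γ.toFun t) = T := by
  have hcont : ContinuousOn (fun t => hatDist K γ.source (γ.toFun t)) (Set.Icc s γ.len) :=
    (continuous_hatDist _).comp_continuousOn
      (γ.continuousOn.mono (Set.Icc_subset_Icc_left hs.1))
  obtain ⟨t, ht, h⟩ := intermediate_value_Icc hs.2 hcont ⟨h1, h2⟩
  exact ⟨t, ht, h⟩

/-- Three bottlenecks are needed because the radius `r₂` of the middle one is not bounded in
advance: a point `r₂`-close to `m₂` in `X` need not be near it for `hatDist`. The outer ones show
that such a point is nevertheless far from the ends. The resulting ball depends on the geodesic, so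
the finite set has no uniform size. -/
theorem finite_hatDist_lt {G : Type v} [Group G] [MulAction G X] [IsIsometricSMul G X]
    (hX : IsGeodesicSpace X) (hK : IsContractionGauge K) (hG : IsProperAction G X) {R : ℝ}
    (hR : 0 < R) {x y : X} (hxy : 2 * R + 1000 ≤ hatDist K x y) :
    {g : G | hatDist K x (g • x) < R ∧ hatDist K y (g • y) < R}.Finite := by
  obtain ⟨γ, rfl, rfl⟩ := hX x y
  set M := R + 200 with hM
  obtain ⟨t₁, ht1, e1⟩ := exists_hatDist_eq (K := K) (T := M) γ.zero_mem
    (by change hatDist K γ.source γ.source ≤ M; rw [hatDist_self]; linarith) (by linarith)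
  have ht1' : t₁ ∈ Set.Icc 0 γ.len := ht1
  obtain ⟨t₂, ht2, e2⟩ := exists_hatDist_eq (K := K) (T := M + 2) ht1' (by linarith) (by linarith)
  have ht2' : t₂ ∈ Set.Icc 0 γ.len := ⟨ht1'.1.trans ht2.1, ht2.2⟩
  obtain ⟨t₃, ht3, e3⟩ := exists_hatDist_eq (K := K) (T := M + 4) ht2' (by linarith) (by linarith)
  have ht3' : t₃ ∈ Set.Icc 0 γ.len := ⟨ht2'.1.trans ht3.1, ht3.2⟩
  obtain ⟨t₄, ht4, e4⟩ := exists_hatDist_eq (K := K) (T := M + 6) ht3' (by linarith) (by linarith)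
  have ht4' : t₄ ∈ Set.Icc 0 γ.len := ⟨ht3'.1.trans ht4.1, ht4.2⟩
  -- A gap of 2 exceeds the bound 1 valid for anti-contracting pairs.
  have hbot : ∀ s t : ℝ, hatDist K γ.source (γ.toFun s) + 2 ≤ hatDist K γ.source (γ.toFun t) →
      ∃ m r, IsBottleneck (γ.toFun s) (γ.toFun t) m r := by
    intro s t hst
    have h1 : 2 ≤ hatDist K (γ.toFun s) (γ.toFun t) := by
      linarith [hatDist_triangle (K := K) γ.source (γ.toFun s) (γ.toFun t)]
    refine exists_isBottleneck hX hK ?_ fun h => by linarith [h.hatDist_le]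
    linarith [hatDist_le_dist (K := K) (γ.toFun s) (γ.toFun t)]
  obtain ⟨m₁, r₁, b1⟩ := hbot t₁ t₂ (by linarith)
  obtain ⟨m₂, r₂, b2⟩ := hbot t₂ t₃ (by linarith)
  obtain ⟨m₃, r₃, b3⟩ := hbot t₃ t₄ (by linarith)
  -- lengths along the geodesic
  have d01 : dist γ.source (γ.toFun t₁) = t₁ - 0 := γ.dist_toFun γ.zero_mem ht1' ht1.1
  have d02 : dist γ.source (γ.toFun t₂) = t₂ - 0 := γ.dist_toFun γ.zero_mem ht2' ht2'.1
  have d12 := γ.dist_toFun ht1' ht2' ht2.1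
  have d23 := γ.dist_toFun ht2' ht3' ht3.1
  have d34 := γ.dist_toFun ht3' ht4' ht4.1
  have d3l : dist (γ.toFun t₃) γ.target = _ := γ.dist_toFun ht3' γ.len_mem ht3.2
  have d4l : dist (γ.toFun t₄) γ.target = _ := γ.dist_toFun ht4' γ.len_mem ht4.2
  have dl := γ.len_eq
  have w2 := b2.btw
  unfold Btw at w2
  have hxm2 : dist γ.source m₂ = dist γ.source (γ.toFun t₂) + dist (γ.toFun t₂) m₂ ∧
      dist m₂ γ.target = dist m₂ (γ.toFun t₃) + dist (γ.toFun t₃) γ.target := by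
    have t1 := dist_triangle γ.source (γ.toFun t₂) m₂
    have t2 := dist_triangle m₂ (γ.toFun t₃) γ.target
    have t3 := dist_triangle γ.source m₂ γ.target
    constructor <;> linarith
  -- the outer bottlenecks are far from the ends in the contraction space
  have far1 : M - 41 ≤ hatDist K γ.source m₁ := by
    have hb : Btw γ.source (γ.toFun t₁) m₁ := by
      have := b1.btw
      unfold Btw at *
      linarith [dist_triangle γ.source (γ.toFun t₁) m₁, dist_triangle γ.source m₁ (γ.toFun t₂)]
    linarith [hatDist_add_le hX hK hb, hatDist_nonneg (K := K) (γ.toFun t₁) m₁]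
  have far3 : R + 200 ≤ hatDist K γ.target m₃ := by
    have hb : Btw γ.target (γ.toFun t₄) m₃ := by
      have := b3.btw
      unfold Btw at *
      rw [dist_comm γ.target, dist_comm γ.target, dist_comm _ m₃]
      linarith [dist_triangle m₃ (γ.toFun t₄) γ.target, dist_triangle (γ.toFun t₃) m₃ γ.target]
    have := hatDist_triangle (K := K) γ.source (γ.toFun t₄) γ.target
    rw [hatDist_comm (γ.toFun t₄) γ.target] at this
    linarith [hatDist_add_le hX hK hb, hatDist_nonneg (K := K) (γ.toFun t₄) m₃]
  have hL := b2.left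
  have hRt := b2.right
  have hr2 := b2.nonneg
  -- This ball contains the geodesic and, with it, the `r₂`-ball around `m₂`. If `g γ` meets the
  -- latter, the ball meets its translate.
  refine (hG (Metric.closedBall γ.source (γ.len + r₂)) Metric.isBounded_closedBall).subset ?_
  rintro g ⟨hgx, hgy⟩
  obtain ⟨α, hαs, hαt⟩ := hX γ.target (g • γ.target)
  obtain ⟨β, hβs, hβt⟩ := hX (g • γ.source) γ.source
  obtain ⟨p, hp, hpm⟩ := b2.meets γ.source γ.target (by linarith) α (γ.translate g).rev β hαs
    (hαt.trans (source_rev (γ.translate g)).symm)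
    ((target_rev (γ.translate g)).trans hβs.symm) hβt
  rcases hp with (hp | hp) | hp
  · exfalso
    have hb := α.btw_of_mem hp
    rw [hαs, hαt] at hb
    have e := hatDist_add_le hX hK hb
    have := b3.symm.hatDist_le hX hK (x := γ.target) (m₂ := m₂) (w := p) (r₂ := r₂) (by
      rw [dist_comm γ.target (γ.toFun t₄), dist_comm (γ.toFun t₄) (γ.toFun t₃),
        dist_comm (γ.toFun t₃) m₂, dist_comm γ.target m₂]
      linarith) (by linarith) (by rw [dist_comm _ m₂]; linarith)
    linarith [hatDist_nonneg (K := K) p (g • γ.target)]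
  · rw [image_rev] at hp
    obtain ⟨t, ht, rfl⟩ := hp
    refine ⟨g • γ.toFun t, Set.smul_mem_smul_set ?_, ?_⟩
    · rw [Metric.mem_closedBall, dist_comm]
      have : dist γ.source (γ.toFun t) = t - 0 := γ.dist_toFun γ.zero_mem ht ht.1
      linarith [show t ≤ γ.len from ht.2]
    · rw [Metric.mem_closedBall, dist_comm]
      change dist (g • γ.toFun t) m₂ ≤ r₂ at hpm
      have t1 := dist_triangle γ.source m₂ (g • γ.toFun t)
      rw [dist_comm m₂] at t1
      linarith [dist_nonneg (x := m₂) (y := γ.toFun t₃), dist_nonneg (x := γ.toFun t₃) (y := γ.target)]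
  · exfalso
    have hb := β.btw_of_mem hp
    rw [hβs, hβt] at hb
    have e := hatDist_add_le hX hK hb
    have := b1.hatDist_le hX hK (x := γ.source) (m₂ := m₂) (w := p) (r₂ := r₂) (by linarith)
      (by linarith) (by linarith)
    rw [hatDist_comm p, hatDist_comm _ γ.source] at e
    rw [hatDist_comm (g • γ.source)] at e
    linarith [hatDist_nonneg (K := K) p (g • γ.source)]

theorem isNonUniformlyAcylindrical_contractionSpace {G : Type v} [Group G] [MulAction G X]
    [IsIsometricSMul G X] (hX : IsGeodesicSpace X) (hK : IsContractionGauge K)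
    (hG : IsProperAction G X) : IsNonUniformlyAcylindrical G (ContractionSpace X K) := by
  refine ⟨isGromovHyperbolic_contractionSpace hX hK, fun R hR => ⟨2 * (R + 2) + 1002,
    by linarith, fun z w hzw => ?_⟩⟩
  obtain ⟨x, hx⟩ := exists_dist_incl_le z
  obtain ⟨y, hy⟩ := exists_dist_incl_le w
  have hxy := abs_le.1 (abs_dist_sub_hatDist_le hx hy)
  refine (finite_hatDist_lt hX hK hG (R := R + 2) (by linarith) (x := x) (y := y)
    (by linarith)).subset ?_
  have hsm : ∀ (g : G) (z : ContractionSpace X K) (x : X), dist z (.incl x) ≤ 1 →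
      dist z (g • z) < R → hatDist K x (g • x) < R + 2 := by
    intro g z x hx h
    have hx' : dist (g • z) (.incl (g • x)) ≤ 1 := by
      rw [← ContractionSpace.smul_incl, dist_smul]
      exact hx
    have := abs_le.1 (abs_dist_sub_hatDist_le hx hx')
    linarith
  exact fun g hg => ⟨hsm g z x hx hg.1, hsm g w y hy hg.2⟩

end Acylindricity

section Axis

variable {X : Type u} [MetricSpace X] {K : ℝ≥0 → ℝ≥0∞}

open GeodesicSegment

/-! ### Contracting quasi-geodesic lines -/

/-- `γ t` is a point of the line `γ` closest to `x`. -/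
def IsProj (γ : ℝ → X) (x : X) (t : ℝ) : Prop := ∀ s, dist x (γ t) ≤ dist x (γ s)

/-- A contracting quasi-geodesic line, described through parameters of closest points. -/
structure IsContractingLine (C : ℝ) (γ : ℝ → X) : Prop where
  one_le : 1 ≤ C
  lower : ∀ s t, |s - t| ≤ C * dist (γ s) (γ t) + C ^ 2
  upper : ∀ s t, dist (γ s) (γ t) ≤ C * |s - t| + C
  exists_proj : ∀ x, ∃ t, IsProj γ x t
  contr : ∀ {x y z : X} {c a b : ℝ}, IsProj γ x c → IsProj γ y a → IsProj γ z b →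
    dist x y < dist x (γ c) → dist x z < dist x (γ c) → dist (γ a) (γ b) ≤ C

theorem IsProj.infDist_eq {γ : ℝ → X} {x : X} {t : ℝ} (h : IsProj γ x t) :
    Metric.infDist x (Set.range γ) = dist x (γ t) := by
  refine le_antisymm (Metric.infDist_le_dist_of_mem ⟨t, rfl⟩) ?_
  rw [Metric.le_infDist (Set.range_nonempty γ)]
  rintro _ ⟨s, rfl⟩
  exact h s

theorem IsProj.mem_closestPoints {γ : ℝ → X} {x : X} {t : ℝ} (h : IsProj γ x t) :
    γ t ∈ closestPoints (Set.range γ) x :=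
  ⟨⟨t, rfl⟩, by rintro _ ⟨s, rfl⟩; exact h s⟩

theorem IsQuasiGeodesicLine.lower {C : ℝ} {γ : ℝ → X} (h : IsQuasiGeodesicLine C γ) (s t : ℝ) :
    |s - t| ≤ C * dist (γ s) (γ t) + C ^ 2 := by
  have hC : 0 < C := by linarith [h.1]
  have h1 := (h.2.2 s t).1
  have h2 : |s - t| / C ≤ dist (γ s) (γ t) + C := by linarith
  rw [div_le_iff₀ hC] at h2
  linarith

theorem IsQuasiGeodesicLine.exists_proj {C : ℝ} {γ : ℝ → X} (h : IsQuasiGeodesicLine C γ)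
    (x : X) : ∃ t, IsProj γ x t := by
  have hC : 0 < C := by linarith [h.1]
  set T := C * (2 * dist x (γ 0)) + C ^ 2 with hT
  have hT0 : 0 ≤ T := by positivity
  have hcont : ContinuousOn (fun t => dist x (γ t)) (Set.Icc (-T) T) :=
    (continuous_const.dist h.2.1).continuousOn
  obtain ⟨t, ht, hmin⟩ := isCompact_Icc.exists_isMinOn ⟨0, by constructor <;> linarith⟩ hcont
  refine ⟨t, fun s => ?_⟩
  by_cases hs : s ∈ Set.Icc (-T) T
  · exact hmin hs
  · have h0 : dist x (γ t) ≤ dist x (γ 0) := hmin (show (0 : ℝ) ∈ _ by constructor <;> linarith)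
    have hs' : T < |s| := by
      by_contra hle
      exact hs (abs_le.1 (not_lt.1 hle))
    have hl := h.lower s 0
    rw [sub_zero] at hl
    have h1 : 2 * dist x (γ 0) < dist (γ s) (γ 0) := by
      refine lt_of_mul_lt_mul_left ?_ hC.le
      linarith
    have := dist_triangle_left (γ s) (γ 0) x
    linarith

theorem IsQuasiGeodesicLine.isContractingLine {C : ℝ} {γ : ℝ → X} (h : IsQuasiGeodesicLine C γ)
    (hc : IsContracting C (Set.range γ)) : IsContractingLine C γ := by
  refine ⟨h.1, h.lower, fun s t => (h.2.2 s t).2, h.exists_proj, ?_⟩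
  intro x y z c a b hx hy hz hxy hxz
  refine hc x y ?_ z ?_ _ hy.mem_closestPoints _ hz.mem_closestPoints
  · rw [Metric.mem_ball, hx.infDist_eq, dist_comm]; exact hxy
  · rw [Metric.mem_ball, hx.infDist_eq, dist_comm]; exact hxz

namespace IsContractingLine

variable {C : ℝ} {γ : ℝ → X}

/-- Reversal turns each one-sided estimate into its mirror image. -/
theorem neg (h : IsContractingLine C γ) : IsContractingLine C fun t => γ (-t) := by
  have hp : ∀ {x t}, IsProj (fun t => γ (-t)) x t → IsProj γ x (-t) := by
    intro x t ht s
    simpa using ht (-s)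
  refine ⟨h.one_le, fun s t => ?_, fun s t => ?_, fun x => ?_, ?_⟩
  · have := h.lower (-s) (-t)
    rwa [show -s - -t = -(s - t) by ring, abs_neg] at this
  · have := h.upper (-s) (-t)
    rwa [show -s - -t = -(s - t) by ring, abs_neg] at this
  · obtain ⟨t, ht⟩ := h.exists_proj x
    exact ⟨-t, fun s => by simpa using ht (-s)⟩
  · intro x y z c a b hx hy hz hxy hxz
    exact h.contr (hp hx) (hp hy) (hp hz) hxy hxz

/-- Either `y` is in the ball around `x` that misses the line, and contraction applies, or `x` and
`y` are within `d(x,y)` and `2 d(x,y)` of their projections. -/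
theorem dist_proj_le (h : IsContractingLine C γ) {x y : X} {a b : ℝ} (hx : IsProj γ x a)
    (hy : IsProj γ y b) : dist (γ a) (γ b) ≤ C + 4 * dist x y := by
  by_cases hlt : dist x y < dist x (γ a)
  · have := h.contr hx hx hy (by rw [dist_self]; exact dist_nonneg.trans_lt hlt) hlt
    linarith [dist_nonneg (x := x) (y := y)]
  · push Not at hlt
    have h1 := hy a
    have t1 := dist_triangle4 (γ a) x y (γ b)
    have t2 := dist_triangle y x (γ a)
    rw [dist_comm (γ a) x] at t1
    rw [dist_comm y x] at t2
    linarith [h.one_le]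

theorem abs_proj_sub_le (h : IsContractingLine C γ) {x y : X} {a b : ℝ} (hx : IsProj γ x a)
    (hy : IsProj γ y b) : |a - b| ≤ 4 * C * dist x y + 2 * C ^ 2 := by
  have hC := h.one_le
  have h1 := h.lower a b
  have h2 := mul_le_mul_of_nonneg_left (h.dist_proj_le hx hy) (show 0 ≤ C by linarith)
  linarith

/-- Far from the line the projection moves at most `C` for every `2C` travelled, that is, at half
speed when measured in `X`. The extra `C` allows for two projections of the same point. -/
theorem dist_proj_le_mul (h : IsContractingLine C γ) (δ : GeodesicSegment X) (N : ℕ) :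
    ∀ {s s' : ℝ}, 0 ≤ s → s ≤ s' → s' ≤ δ.len →
      (∀ t ∈ Set.Icc s s', ∀ c, 4 * C ≤ dist (δ.toFun t) (γ c)) → s' - s ≤ 2 * C * N →
      ∀ {a b : ℝ}, IsProj γ (δ.toFun s) a → IsProj γ (δ.toFun s') b →
        dist (γ a) (γ b) ≤ C * (N + 1) := by
  have hC := h.one_le
  induction N with
  | zero =>
    intro s s' hs hss hs' hfar hN a b ha hb
    have : s' = s := by
      simp only [Nat.cast_zero, mul_zero] at hN
      linarith
    subst this
    simpa using h.dist_proj_le ha hb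
  | succ N ih =>
    intro s s' hs hss hs' hfar hN a b ha hb
    push_cast at hN ⊢
    set t := max s (s' - 2 * C) with ht
    have t1 : s ≤ t := le_max_left _ _
    have t2 : s' - 2 * C ≤ t := le_max_right _ _
    have t3 : t ≤ s' := max_le hss (by linarith)
    obtain ⟨c, hc⟩ := h.exists_proj (δ.toFun t)
    have h1 := ih hs t1 (t3.trans hs') (fun u hu => hfar u ⟨hu.1, hu.2.trans t3⟩) (by
      rcases max_choice s (s' - 2 * C) with e | e
      · rw [ht, e, sub_self]; positivity
      · rw [ht, e]; linarith) ha hc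
    have hd := δ.dist_toFun ⟨hs.trans t1, t3.trans hs'⟩ ⟨hs.trans hss, hs'⟩ t3
    have hf := hfar t ⟨t1, t3⟩ c
    have h2 := h.contr hc hc hb (by rw [dist_self]; linarith) (by rw [hd]; linarith)
    linarith [dist_triangle (γ a) (γ c) (γ b)]

/-- A geodesic far from a contracting line has a bounded projection. -/
theorem dist_proj_le_of_far (h : IsContractingLine C γ) (δ : GeodesicSegment X) {s s' : ℝ}
    (hs : 0 ≤ s) (hss : s ≤ s') (hs' : s' ≤ δ.len)
    (hfar : ∀ t ∈ Set.Icc s s', ∀ c, 4 * C ≤ dist (δ.toFun t) (γ c)) {a b : ℝ}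
    (ha : IsProj γ (δ.toFun s) a) (hb : IsProj γ (δ.toFun s') b) :
    dist (γ a) (γ b) ≤ 10 * C := by
  have hC := h.one_le
  have fa := hfar s ⟨le_rfl, hss⟩ a
  have fb := hfar s' ⟨hss, le_rfl⟩ b
  have hd := δ.dist_toFun ⟨hs, hss.trans hs'⟩ ⟨hs.trans hss, hs'⟩ hss
  have tri := dist_triangle4 (δ.toFun s) (γ a) (γ b) (δ.toFun s')
  rw [dist_comm (γ b) (δ.toFun s')] at tri
  set p := dist (δ.toFun s) (γ a)
  set q := dist (δ.toFun s') (γ b)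
  by_cases h1 : s' - s < p
  · have := h.contr ha ha hb (by rw [dist_self]; linarith) (by rw [hd]; exact h1)
    linarith
  push Not at h1
  -- The initial stretch of length `p - C` stays strictly inside the ball around the first end, so
  -- its projection is bounded; `t'` plays the same role at the other end. In between the projection
  -- has half speed, and `s' - s ≤ p + q + d(γ a, γ b)`. So `d(γ a, γ b)` is at most half of itself
  -- plus `5C`.
  set t := s + p - C with ht
  obtain ⟨c, hc⟩ := h.exists_proj (δ.toFun t)
  have dt := δ.dist_toFun (s := s) (t := t) ⟨hs, hss.trans hs'⟩ ⟨by linarith, by linarith⟩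
    (by linarith)
  have e1 := h.contr ha ha hc (by rw [dist_self]; linarith) (by rw [dt]; linarith)
  have dt' := δ.dist_toFun (s := t) (t := s') ⟨by linarith, by linarith⟩ ⟨by linarith, hs'⟩
    (by linarith)
  have tr1 := dist_triangle (γ a) (γ c) (γ b)
  by_cases h2 : s' - t < q
  · have e2 := h.contr hb hc hb (by rw [dist_comm, dt']; exact h2) (by rw [dist_self]; linarith)
    linarith
  push Not at h2
  set t' := s' - q + C with ht'
  obtain ⟨c', hc'⟩ := h.exists_proj (δ.toFun t')
  have dt2 := δ.dist_toFun (s := t') (t := s') ⟨by linarith, by linarith⟩ ⟨by linarith, hs'⟩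
    (by linarith)
  have e2 := h.contr hb hc' hb (by rw [dist_comm, dt2]; linarith) (by rw [dist_self]; linarith)
  have hN := Nat.le_ceil ((t' - t) / (2 * C))
  have hN' := Nat.ceil_lt_add_one (show 0 ≤ (t' - t) / (2 * C) from
    div_nonneg (by linarith) (by linarith))
  set N := ⌈(t' - t) / (2 * C)⌉₊
  rw [div_le_iff₀ (by linarith)] at hN
  have e3 := h.dist_proj_le_mul δ N (s := t) (s' := t') (by linarith) (by linarith) (by linarith)
    (fun u hu => hfar u ⟨by linarith [hu.1], by linarith [hu.2]⟩) (by linarith) hc hc'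
  have e4 : C * N ≤ (t' - t) / 2 + C := by
    have := mul_le_mul_of_nonneg_left hN'.le (show 0 ≤ C by linarith)
    have e : C * ((t' - t) / (2 * C) + 1) = (t' - t) / 2 + C := by
      field_simp
    linarith
  have tr2 := dist_triangle (γ c) (γ c') (γ b)
  linarith

/-- A geodesic whose end points project to both sides of `γ T` passes close to `γ T`. -/
theorem exists_near (h : IsContractingLine C γ) (δ : GeodesicSegment X) {s s' T : ℝ}
    (hs : IsProj γ δ.source s) (hs' : IsProj γ δ.target s') (hT : s ≤ T - 20 * C ^ 3)
    (hT' : T ≤ s') : ∃ z ∈ δ.image, dist z (γ T) ≤ 22 * C ^ 3 := by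
  have hC := h.one_le
  have hC2 : C ≤ C ^ 2 := by nlinarith
  have hC3 : C ^ 2 ≤ C ^ 3 := by nlinarith [sq_nonneg C]
  have hl := δ.len_nonneg
  -- a point projecting close to `γ T`
  obtain ⟨t, ht, c, hc, hcT⟩ : ∃ t ∈ Set.Icc 0 δ.len, ∃ c, IsProj γ (δ.toFun t) c ∧
      |c - T| ≤ 2 * C ^ 2 + 4 * C := by
    -- A discrete intermediate value argument, as projections may jump: a parameter within one of
    -- the supremum of `E` has, at most one further, a point projecting beyond `T`.
    let E : Set ℝ := {t | t ∈ Set.Icc 0 δ.len ∧ ∃ c, IsProj γ (δ.toFun t) c ∧ c ≤ T}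
    have hE0 : (0 : ℝ) ∈ E := ⟨δ.zero_mem, s, hs, by nlinarith⟩
    have hEb : BddAbove E := ⟨δ.len, fun t ht => ht.1.2⟩
    obtain ⟨t, ⟨ht, c, hc, hcT⟩, htE⟩ := exists_lt_of_lt_csSup ⟨0, hE0⟩
      (show sSup E - 1 < sSup E by linarith)
    obtain ⟨t', ht', htt', htt1, c', hc', hcT'⟩ : ∃ t' ∈ Set.Icc 0 δ.len, t ≤ t' ∧ t' ≤ t + 1 ∧
        ∃ c', IsProj γ (δ.toFun t') c' ∧ T ≤ c' := by
      by_cases hlen : t + 1 ≤ δ.len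
      · have hm : t + 1 ∈ Set.Icc 0 δ.len := ⟨by linarith [ht.1], hlen⟩
        obtain ⟨c', hc'⟩ := h.exists_proj (δ.toFun (t + 1))
        refine ⟨t + 1, hm, by linarith, le_rfl, c', hc', ?_⟩
        by_contra hlt
        have := le_csSup hEb (show t + 1 ∈ E from ⟨hm, c', hc', by linarith⟩)
        linarith
      · exact ⟨δ.len, δ.len_mem, ht.2, by linarith, s', hs', hT'⟩
    refine ⟨t, ht, c, hc, ?_⟩
    have e := h.abs_proj_sub_le hc hc'
    rw [δ.dist_toFun ht ht' htt'] at e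
    have e2 := mul_le_mul_of_nonneg_left (show t' - t ≤ 1 by linarith)
      (show 0 ≤ 4 * C by linarith)
    rw [abs_sub_comm, abs_of_nonneg (by linarith)] at e ⊢
    linarith
  -- go back until the line is close
  obtain ⟨z, hz, c', hc', hzc, hcc⟩ : ∃ z ∈ δ.image, ∃ c', IsProj γ z c' ∧
      dist z (γ c') ≤ 5 * C ∧ dist (γ c') (γ c) ≤ 10 * C := by
    let f : ℝ → ℝ := fun w => Metric.infDist (δ.toFun w) (Set.range γ)
    have hf : ContinuousOn f (Set.Icc 0 t) :=
      (Metric.continuous_infDist_pt _).comp_continuousOn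
        (δ.continuousOn.mono (Set.Icc_subset_Icc_right ht.2))
    have hfar : ∀ w, ¬ f w ≤ 4 * C → ∀ c, 4 * C ≤ dist (δ.toFun w) (γ c) := fun w hw c =>
      (not_le.1 hw).le.trans (Metric.infDist_le_dist_of_mem ⟨c, rfl⟩)
    let E : Set ℝ := Set.Icc 0 t ∩ f ⁻¹' Set.Iic (4 * C)
    have hE : IsCompact E := isCompact_Icc.of_isClosed_subset
      (hf.preimage_isClosed_of_isClosed isClosed_Icc isClosed_Iic) Set.inter_subset_left
    by_cases hne : E.Nonempty
    · obtain ⟨w, ⟨hw, hfw⟩, hmax⟩ := hE.exists_isMaxOn hne continuousOn_id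
      change f w ≤ 4 * C at hfw
      rcases eq_or_lt_of_le hw.2 with rfl | hlt
      · refine ⟨_, ⟨w, ht, rfl⟩, c, hc, ?_, ?_⟩
        · rw [← hc.infDist_eq]; linarith [hfw]
        · rw [dist_self]; linarith
      -- Stepping past the last parameter `w` at which the line is `4C`-close keeps the distance
      -- below `5C` and makes the rest of the segment far from the line.
      · set w' := min (w + C) t
        have h1 : w < w' := lt_min (by linarith) hlt
        have h2 : w' ≤ t := min_le_right _ _
        have h3 : w' ≤ w + C := min_le_left _ _
        have hm' : w' ∈ Set.Icc 0 δ.len := ⟨by linarith [hw.1], h2.trans ht.2⟩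
        obtain ⟨c', hc'⟩ := h.exists_proj (δ.toFun w')
        refine ⟨_, ⟨w', hm', rfl⟩, c', hc', ?_, ?_⟩
        · rw [← hc'.infDist_eq]
          have := Metric.infDist_le_infDist_add_dist (s := Set.range γ) (x := δ.toFun w')
            (y := δ.toFun w)
          rw [dist_comm, δ.dist_toFun ⟨hw.1, by linarith [ht.2]⟩ hm' h1.le] at this
          change _ ≤ f w + _ at this
          linarith
        · refine h.dist_proj_le_of_far δ hm'.1 h2 ht.2 (fun v hv => hfar v fun hle => ?_) hc' hc
          have : v ≤ w := hmax (show v ∈ E from ⟨⟨hm'.1.trans hv.1, hv.2⟩, hle⟩)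
          linarith [hv.1]
    -- A segment far from the line throughout moves its projection by at most `10C`, hence its
    -- parameter by at most `11C²`, which is too little to get from `s` to near `T`.
    · exfalso
      have e := h.dist_proj_le_of_far δ le_rfl ht.1 ht.2
        (fun v hv => hfar v fun hle => hne ⟨v, hv, hle⟩) hs hc
      have e1 := h.lower s c
      have e2 := mul_le_mul_of_nonneg_left e (show 0 ≤ C by linarith)
      have e3 := abs_le.1 e1
      have e4 := abs_le.1 hcT
      nlinarith
  refine ⟨z, hz, ?_⟩
  -- The bound is `5C + 10C + (C(2C² + 4C) + C)`, at most `22C³` since `C ≥ 1`.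
  have e1 := h.upper c T
  have e2 := mul_le_mul_of_nonneg_left hcT (show 0 ≤ C by linarith)
  have e3 := dist_triangle4 z (γ c') (γ c) (γ T)
  nlinarith

theorem exists_near' (h : IsContractingLine C γ) (δ : GeodesicSegment X) {s s' T : ℝ}
    (hs : IsProj γ δ.source s) (hs' : IsProj γ δ.target s') (hT : s' ≤ T - 20 * C ^ 3)
    (hT' : T ≤ s) : ∃ z ∈ δ.image, dist z (γ T) ≤ 22 * C ^ 3 := by
  rw [← image_rev]
  exact h.exists_near δ.rev (by rw [source_rev]; exact hs') (by rw [target_rev]; exact hs) hT hT'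

theorem abs_sub_le_of_near (h : IsContractingLine C γ) {x : X} {c T r : ℝ} (hx : IsProj γ x c)
    (hT : dist x (γ T) ≤ r) : |c - T| ≤ 2 * C * r + C ^ 2 := by
  have hC := h.one_le
  have h1 := hx T
  have h2 := dist_triangle_left (γ c) (γ T) x
  have h3 := mul_le_mul_of_nonneg_left (show dist (γ c) (γ T) ≤ 2 * r by linarith)
    (show 0 ≤ C by linarith)
  linarith [h.lower c T]

/-- If `e` projected beyond `T - 60C³`, the geodesic from `e` to `k` would pass some `z` close to `γ
(T - 60C³)` before reaching `k`. Then `k` is between `z` and `m`, so `d(k,m) ≤ d(z,m)`; but `k` is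
near the far away point `γ (T - q)`. The bound on `q` is what this contradiction requires. -/
theorem proj_le_of_btw (h : IsContractingLine C γ) (hX : IsGeodesicSpace X) {e k m : X}
    {x T q : ℝ} (hekm : Btw e k m) (hm : dist m (γ T) ≤ 22 * C ^ 3)
    (hk : dist k (γ (T - q)) ≤ 22 * C ^ 3) (hx : IsProj γ e x)
    (hq : 100 * C ^ 3 + C * (2 * C * (22 * C ^ 3) + C ^ 2) + 4 * C * (22 * C ^ 3)
      + C ^ 2 * (100 * C ^ 3) + 3 * C ^ 2 ≤ q) : x ≤ T - 60 * C ^ 3 := by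
  have hC := h.one_le
  by_contra hlt
  push Not at hlt
  obtain ⟨ε, hεs, hεt⟩ := hX e k
  obtain ⟨c, hc⟩ := h.exists_proj k
  have hcT := abs_le.1 (h.abs_sub_le_of_near hc hk)
  have hq0 : 2 * C * (22 * C ^ 3) + C ^ 2 ≤ C * (2 * C * (22 * C ^ 3) + C ^ 2) :=
    le_mul_of_one_le_left (by positivity) hC
  have p1 : 0 ≤ C ^ 3 := by positivity
  have p2 : 0 ≤ 4 * C * (22 * C ^ 3) := by positivity
  have p3 : 0 ≤ C ^ 2 * (100 * C ^ 3) := by positivity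
  have p4 : 0 ≤ C ^ 2 := by positivity
  obtain ⟨z, hz, hzT⟩ := h.exists_near' ε (hεs.symm ▸ hx) (hεt.symm ▸ hc)
    (T := T - 60 * C ^ 3) (by linarith) hlt.le
  have hbz : Btw e z k := hεs ▸ hεt ▸ ε.btw_of_mem hz
  have hkm : dist k m ≤ dist z m := by
    have := (hekm.mid hbz).dist_le_right
    exact this
  have u1 := h.upper (T - 60 * C ^ 3) T
  rw [show T - 60 * C ^ 3 - T = -(60 * C ^ 3) by ring, abs_neg, abs_of_nonneg (by linarith)] at u1
  have l1 := h.lower (T - q) T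
  rw [show T - q - T = -q by ring, abs_neg, abs_of_nonneg (by linarith)] at l1
  have t1 := dist_triangle4 z (γ (T - 60 * C ^ 3)) (γ T) m
  have t2 := dist_triangle4 (γ (T - q)) k m (γ T)
  rw [dist_comm (γ T) m] at t1
  rw [dist_comm _ k] at t2
  have l2 := mul_le_mul_of_nonneg_left
    (show dist (γ (T - q)) (γ T) ≤ 4 * (22 * C ^ 3) + (C * (60 * C ^ 3) + C) by linarith)
    (show 0 ≤ C by linarith)
  nlinarith

end IsContractingLine

end Axis

/-! ### Thin segments along contracting lines and projections of chains -/

section AxisThin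

variable {X : Type u} [MetricSpace X] {K : ℝ≥0 → ℝ≥0∞}

open GeodesicSegment

/-- How far from `γ T` a geodesic has to follow `γ` on both sides in order to be thin there. -/
noncomputable def followLength (C : ℝ) : ℝ :=
  100 * C ^ 3 + C * (2 * C * (22 * C ^ 3) + C ^ 2) + 4 * C * (22 * C ^ 3)
    + C ^ 2 * (100 * C ^ 3) + 3 * C ^ 2

/-- The thinness constant of geodesics that follow a contracting line. -/
noncomputable def thinConst (C : ℝ) : ℝ := C * followLength C + C + 2 * (22 * C ^ 3)

namespace IsContractingLine

variable {C : ℝ} {γ : ℝ → X}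

/-- By `proj_le_of_btw` and its mirror image, the ends of any geodesic extending `κ` project beyond
`T - 60C³` and `T + 60C³`. The other three sides of a quadrangle lead back from one to the other,
and by `exists_near'` one of them passes close to the line near `γ T`. -/
theorem isThin (h : IsContractingLine C γ) (hX : IsGeodesicSpace X) {κ : GeodesicSegment X}
    {a b T : ℝ} (ha : a ∈ Set.Icc 0 (κ.len / 2)) (hb : b ∈ Set.Icc (κ.len / 2) κ.len)
    (hm : dist κ.midpoint (γ T) ≤ 22 * C ^ 3)
    (hka : dist (κ.toFun a) (γ (T - followLength C)) ≤ 22 * C ^ 3)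
    (hkb : dist (κ.toFun b) (γ (T + followLength C)) ≤ 22 * C ^ 3) :
    κ.IsThin (thinConst C) := by
  have hC := h.one_le
  have hl := κ.len_nonneg
  have p1 : 0 ≤ C ^ 3 := by positivity
  have hr : 2 * (22 * C ^ 3) + C * (40 * C ^ 3) + C ≤ thinConst C := by
    unfold thinConst
    have : 40 * C ^ 3 ≤ followLength C := by
      unfold followLength
      have p2 : 0 ≤ 4 * C * (22 * C ^ 3) := by positivity
      have p3 : 0 ≤ C ^ 2 * (100 * C ^ 3) := by positivity
      have p4 : 0 ≤ C ^ 2 := by positivity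
      have p5 : 0 ≤ C * (2 * C * (22 * C ^ 3) + C ^ 2) := by positivity
      linarith
    have := mul_le_mul_of_nonneg_left this (show 0 ≤ C by linarith)
    linarith
  intro γ₁ γ₂ γ₃ γ₄ h12 h23 h34 h41 hsub
  obtain ⟨o, ho, hol, hof⟩ := hsub
  have hmid : κ.midpoint = γ₁.toFun (o + κ.len / 2) := hof _ ⟨by linarith, by linarith⟩
  have bt1 : Btw γ₁.source (κ.toFun a) κ.midpoint := by
    rw [hmid, hof a ⟨ha.1, by linarith [ha.2]⟩]
    exact γ₁.btw_toFun le_rfl (by linarith [ha.1]) (by linarith [ha.2]) (by linarith)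
  have bt2 : Btw γ₁.target (κ.toFun b) κ.midpoint := by
    rw [hmid, hof b ⟨by linarith [hb.1], hb.2⟩]
    exact (γ₁.btw_toFun (by linarith) (by linarith [hb.1]) (by linarith [hb.2]) le_rfl).symm
  obtain ⟨x₁, hx1⟩ := h.exists_proj γ₁.source
  obtain ⟨x₂, hx2⟩ := h.exists_proj γ₁.target
  obtain ⟨x₃, hx3⟩ := h.exists_proj γ₂.target
  obtain ⟨x₄, hx4⟩ := h.exists_proj γ₃.target
  have l1 := h.proj_le_of_btw hX bt1 hm hka hx1 le_rfl
  have l2 := h.neg.proj_le_of_btw hX (x := -x₂) (T := -T) (q := followLength C) bt2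
    (by simpa using hm) (by
      rw [show -(-T - followLength C) = T + followLength C by ring]
      exact hkb) (fun s => by simpa using hx2 (-s)) le_rfl
  by_contra hcon
  push Not at hcon
  have hside : ∀ δ : GeodesicSegment X, δ.image ⊆ γ₂.image ∪ γ₃.image ∪ γ₄.image →
      ∀ s s' T', IsProj γ δ.source s → IsProj γ δ.target s' → |T' - T| ≤ 40 * C ^ 3 →
      T' ≤ s → T' - 20 * C ^ 3 < s' := by
    intro δ hδ s s' T' hs hs' hT' h1
    by_contra h2
    push Not at h2
    obtain ⟨z, hz, hzT⟩ := h.exists_near' δ hs hs' h2 h1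
    refine hcon z (hδ hz) ?_
    rw [Metric.mem_closedBall]
    have u := h.upper T' T
    have u' := mul_le_mul_of_nonneg_left hT' (show 0 ≤ C by linarith)
    have t := dist_triangle4 z (γ T') (γ T) κ.midpoint
    rw [dist_comm (γ T) κ.midpoint] at t
    linarith
  -- A side missing the ball drops less than `20C³` below the levels `T + 40C³`, `T`, `T - 40C³` in
  -- turn. So after three sides the projection is still above `T - 60C³`.
  have s2 := hside γ₂ (fun p hp => Or.inl (Or.inl hp)) x₂ x₃ (T + 40 * C ^ 3) (h12 ▸ hx2) hx3
    (by rw [add_sub_cancel_left, abs_of_nonneg (by linarith)]) (by linarith)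
  have s3 := hside γ₃ (fun p hp => Or.inl (Or.inr hp)) x₃ x₄ T (h23 ▸ hx3) hx4
    (by rw [sub_self, abs_zero]; linarith) (by linarith)
  have s4 := hside γ₄ (fun p hp => Or.inr hp) x₄ x₁ (T - 40 * C ^ 3) (h34 ▸ hx4) (h41 ▸ hx1)
    (by rw [show T - 40 * C ^ 3 - T = -(40 * C ^ 3) by ring, abs_neg,
      abs_of_nonneg (by linarith)]) (by linarith)
  linarith

/-- A long enough geodesic along a contracting line contains thin subsegments of prescribed
length. -/
theorem exists_isThin (h : IsContractingLine C γ) (hX : IsGeodesicSpace X) {L : ℝ}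
    (hL : 2 * thinConst C ≤ L) {δ : GeodesicSegment X} {s s' : ℝ} (hs : IsProj γ δ.source s)
    (hs' : IsProj γ δ.target s')
    (hss : 4 * followLength C + 4 * C * L + 100 * C ^ 3 ≤ s' - s) :
    ∃ κ : GeodesicSegment X, κ.IsSubsegment δ ∧ κ.len = L ∧ κ.IsThin (thinConst C) := by
  have hC := h.one_le
  have p1 : 0 ≤ C ^ 3 := by positivity
  have hC2 : C ^ 2 ≤ C ^ 3 := by nlinarith [sq_nonneg C]
  have hqj : 20 * C ^ 3 + (2 * C * (22 * C ^ 3) + C ^ 2) ≤ followLength C := by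
    unfold followLength
    have p2 : 0 ≤ 4 * C * (22 * C ^ 3) := by positivity
    have p3 : 0 ≤ C ^ 2 * (100 * C ^ 3) := by positivity
    have p4 : 0 ≤ C ^ 2 := by positivity
    have hq0 : 2 * C * (22 * C ^ 3) + C ^ 2 ≤ C * (2 * C * (22 * C ^ 3) + C ^ 2) :=
      le_mul_of_one_le_left (by positivity) hC
    linarith
  have pj : 0 ≤ 2 * C * (22 * C ^ 3) + C ^ 2 := by positivity
  have hr0 : 0 ≤ thinConst C := by
    unfold thinConst
    have := mul_nonneg (show 0 ≤ C by linarith) (show 0 ≤ followLength C by linarith)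
    linarith
  have hCL : 0 ≤ C * L := mul_nonneg (by linarith) (by linarith)
  set q := followLength C with hq
  set T := (s + s') / 2 with hT
  obtain ⟨_, ⟨w, hw, rfl⟩, hm⟩ := h.exists_near δ hs hs' (T := T) (by linarith) (by linarith)
  obtain ⟨c, hc⟩ := h.exists_proj (δ.toFun w)
  have hcT := abs_le.1 (h.abs_sub_le_of_near hc hm)
  -- points of the segment on both sides
  obtain ⟨a, ha, hka⟩ : ∃ a ∈ Set.Icc 0 w, dist (δ.toFun a) (γ (T - q)) ≤ 22 * C ^ 3 := by
    obtain ⟨_, ⟨a, ha, rfl⟩, hk⟩ := h.exists_near (δ.sub 0 w le_rfl hw.1 hw.2) (s := s) (s' := c)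
      (T := T - q) (by simpa [source, sub] using hs) (by simpa [target, sub] using hc)
      (by linarith) (by linarith)
    exact ⟨a, ⟨ha.1, by simpa [sub] using ha.2⟩, by simpa [sub] using hk⟩
  obtain ⟨b, hb, hkb⟩ : ∃ b ∈ Set.Icc w δ.len, dist (δ.toFun b) (γ (T + q)) ≤ 22 * C ^ 3 := by
    obtain ⟨_, ⟨b, hb, rfl⟩, hk⟩ := h.exists_near (δ.sub w δ.len hw.1 hw.2 le_rfl) (s := c)
      (s' := s') (T := T + q) (by simpa [source, sub] using hc) (by simpa [target, sub] using hs')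
      (by linarith) (by linarith)
    have hb2 : b ≤ δ.len - w := hb.2
    exact ⟨w + b, ⟨by linarith [hb.1], by linarith⟩, hk⟩
  have hnear : ∀ (p : X) (T' : ℝ), dist p (γ T') ≤ 22 * C ^ 3 → |T' - T| ≤ q →
      dist p (δ.toFun w) ≤ thinConst C := by
    intro p T' hp hT'
    have u := h.upper T' T
    have u' := mul_le_mul_of_nonneg_left hT' (show 0 ≤ C by linarith)
    have t := dist_triangle4 p (γ T') (γ T) (δ.toFun w)
    rw [dist_comm (γ T)] at t
    unfold thinConst
    linarith
  have da := hnear _ _ hka (by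
    rw [show T - q - T = -q by ring, abs_neg, abs_of_nonneg (by linarith)])
  have db := hnear _ _ hkb (by rw [add_sub_cancel_left, abs_of_nonneg (by linarith)])
  rw [δ.dist_toFun ⟨ha.1, ha.2.trans hw.2⟩ hw ha.2] at da
  rw [dist_comm, δ.dist_toFun hw ⟨hw.1.trans hb.1, hb.2⟩ hb.1] at db
  -- the ends are far from the middle
  have hfar : ∀ (p : X) (t : ℝ), IsProj γ p t → 2 * q + 2 * C * L + 50 * C ^ 3 ≤ |t - T| →
      L / 2 ≤ dist p (δ.toFun w) := by
    intro p t hp ht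
    have e := h.abs_proj_sub_le hp hc
    have e' : |t - T| ≤ |t - c| + |c - T| := abs_sub_le t c T
    have e'' : |c - T| ≤ 2 * C * (22 * C ^ 3) + C ^ 2 := abs_le.2 hcT
    have : C * (2 * L) ≤ C * (4 * dist p (δ.toFun w)) := by linarith
    linarith [le_of_mul_le_mul_left this (by linarith)]
  have fs := hfar δ.source s hs (by
    rw [abs_sub_comm, abs_of_nonneg (by linarith)]; linarith)
  have fs' := hfar δ.target s' hs' (by rw [abs_of_nonneg (by linarith)]; linarith)
  have es : dist δ.source (δ.toFun w) = w - 0 := δ.dist_toFun δ.zero_mem hw hw.1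
  have es' : dist (δ.toFun w) δ.target = δ.len - w := δ.dist_toFun hw δ.len_mem hw.2
  rw [dist_comm] at fs'
  -- Since `thinConst C ≤ L / 2`, the points at `a` and `b` that follow the line lie in `κ`, one in
  -- each half.
  set κ := δ.sub (w - L / 2) (w + L / 2) (by linarith) (by linarith) (by linarith) with hκ
  have hlen : κ.len = L := by
    change w + L / 2 - (w - L / 2) = L
    ring
  have hval : ∀ t, κ.toFun t = δ.toFun (w - L / 2 + t) := fun t => rfl
  refine ⟨κ, ⟨w - L / 2, by linarith, by linarith, fun t _ => rfl⟩, hlen,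
    h.isThin hX (T := T) (a := a - (w - L / 2)) (b := b - (w - L / 2)) ?_ ?_ ?_ ?_ ?_⟩
  · rw [hlen]
    constructor <;> linarith [ha.2]
  · rw [hlen]
    constructor <;> linarith [hb.1]
  · unfold GeodesicSegment.midpoint
    rw [hval, hlen, sub_add_cancel]
    exact hm
  · rw [hval, add_sub_cancel]
    exact hka
  · rw [hval, add_sub_cancel]
    exact hkb

/-- Fullness enters here: with `r = thinConst C` the value `K r` is a finite length, so a geodesic
with widely spread projections contains an `r`-thin segment of length exactly `K r`. The bound
depends on `C` but not on the line, so it also serves for the reversed one. -/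
theorem exists_proj_sub_le_of_isAntiContracting (h : IsContractingLine C γ)
    (hX : IsGeodesicSpace X) (hK : IsFullGauge K)
    (hK10 : ∀ r : ℝ≥0, 10 * (r : ℝ≥0∞) + 1 ≤ K r) :
    ∃ M : ℝ, ∀ γ : ℝ → X, IsContractingLine C γ → ∀ x y s t, IsAntiContracting K x y →
      IsProj γ x s → IsProj γ y t → t - s ≤ M := by
  have hr0 : 0 ≤ thinConst C := by
    have := h.one_le
    unfold thinConst followLength
    positivity
  let r : ℝ≥0 := ⟨thinConst C, hr0⟩
  have hL : 2 * thinConst C ≤ (K r).toReal := by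
    have := ENNReal.toReal_mono (hK.2 r) (hK10 r)
    rw [ENNReal.toReal_add (by finiteness) (by finiteness)] at this
    simp only [ENNReal.toReal_mul, ENNReal.toReal_ofNat, ENNReal.coe_toReal,
      ENNReal.toReal_one] at this
    have e : (r : ℝ) = thinConst C := rfl
    rw [e] at this
    linarith
  refine ⟨4 * followLength C + 4 * C * (K r).toReal + 100 * C ^ 3, fun γ h x y s t hxy hs ht => ?_⟩
  by_contra hlt
  push Not at hlt
  obtain ⟨δ, rfl, rfl⟩ := hX x y
  obtain ⟨κ, hsub, hlen, hthin⟩ := h.exists_isThin hX hL hs ht hlt.le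
  refine hxy.2 r δ κ rfl rfl hsub ?_ hthin
  rw [hlen, ENNReal.ofReal_toReal (hK.2 r)]

theorem exists_abs_proj_sub_le_of_adj (h : IsContractingLine C γ) (hX : IsGeodesicSpace X)
    (hK : IsFullGauge K) (hK10 : ∀ r : ℝ≥0, 10 * (r : ℝ≥0∞) + 1 ≤ K r) :
    ∃ M : ℝ, 2 * C ^ 2 ≤ M ∧ ∀ x y s t, Adj K x y → IsProj γ x s → IsProj γ y t →
      |s - t| ≤ M := by
  obtain ⟨M, hM⟩ := h.exists_proj_sub_le_of_isAntiContracting hX hK hK10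
  have hC := h.one_le
  have hanti : ∀ x y s t, IsAntiContracting K x y → IsProj γ x s → IsProj γ y t →
      |s - t| ≤ M := by
    intro x y s t hxy hs ht
    have h1 := hM γ h x y s t hxy hs ht
    have h2 := hM _ h.neg x y (-s) (-t) hxy (fun u => by simpa using hs (-u))
      (fun u => by simpa using ht (-u))
    rw [abs_le]
    constructor <;> linarith
  refine ⟨max M (4 * C + 2 * C ^ 2), le_max_of_le_right (by linarith), ?_⟩
  rintro x y s t (hxy | hxy | hxy) hs ht
  · refine le_max_of_le_right ((h.abs_proj_sub_le hs ht).trans ?_)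
    have := mul_le_mul_of_nonneg_left hxy (show 0 ≤ 4 * C by linarith)
    linarith
  · exact le_max_of_le_left (hanti x y s t hxy hs ht)
  · rw [abs_sub_comm]
    exact le_max_of_le_left (hanti y x t s hxy ht hs)

/-- The closest point projection to a contracting line is coarsely Lipschitz for the distance of
the contraction space. -/
theorem exists_abs_proj_sub_le (h : IsContractingLine C γ) (hX : IsGeodesicSpace X)
    (hK : IsFullGauge K) (hK10 : ∀ r : ℝ≥0, 10 * (r : ℝ≥0∞) + 1 ≤ K r) :
    ∃ M : ℝ, 0 ≤ M ∧ ∀ x y s t, IsProj γ x s → IsProj γ y t →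
      |s - t| ≤ M * (2 * hatDist K x y + 4) := by
  obtain ⟨M, hMC, hM⟩ := h.exists_abs_proj_sub_le_of_adj hX hK hK10
  have hM0 : 0 ≤ M := le_trans (by positivity) hMC
  refine ⟨M, hM0, fun x y s t hs ht => ?_⟩
  obtain ⟨n, c, rfl, rfl, hc⟩ := exists_isGoodChain (K := K) hX x y
  -- Each step of the chain moves the projection by at most `M`, and a good chain has at most `2
  -- hatDist + 3` steps. The extra `M` covers the choice of projection at the start.
  have hind : ∀ k ≤ n, ∀ u, IsProj γ (c k) u → |s - u| ≤ M * (k + 1) := by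
    intro k
    induction k with
    | zero =>
      intro _ u hu
      have := h.abs_proj_sub_le hs hu
      rw [dist_self] at this
      simp only [Nat.cast_zero, zero_add, mul_one]
      linarith
    | succ k ih =>
      intro hk u hu
      obtain ⟨w, hw⟩ := h.exists_proj (c k)
      have h1 := ih (by omega) w hw
      have h2 := hM _ _ _ _ (hc.isChain k (by omega)) hw hu
      have h3 := abs_sub_le s w u
      push_cast
      linarith
  have hn := hc.le_hatDist 0 n (Nat.zero_le _) le_rfl
  rw [Nat.cast_zero, sub_zero] at hn
  exact (hind n le_rfl t ht).trans (mul_le_mul_of_nonneg_left (by linarith) hM0)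

end IsContractingLine

/-- The points `g ^ k • γ 0` lie on the line and project to themselves. A bounded orbit bounds their
`hatDist`, hence their parameters, hence their distances in `X`, against the linear growth of `g ^ k
• x₀`. -/
theorem hasUnboundedOrbits_contractionSpace {G : Type v} [Group G] [MulAction G X]
    [IsIsometricSMul G X] (hX : IsGeodesicSpace X) (hK : IsFullGauge K)
    (hK10 : ∀ r : ℝ≥0, 10 * (r : ℝ≥0∞) + 1 ≤ K r) {g : G}
    (hg : HasStronglyContractingAxis X g) : HasUnboundedOrbits G (ContractionSpace X K) := by
  obtain ⟨⟨x₀, L, hL, hlox⟩, C, γ, hγ, hcontr, hinv⟩ := hg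
  have h := hγ.isContractingLine hcontr
  obtain ⟨M, hM0, hM⟩ := h.exists_abs_proj_sub_le hX hK hK10
  intro y hb
  obtain ⟨R, hR⟩ := Metric.isBounded_iff.1 hb
  have hpow : ∀ k : ℕ, ∃ t, γ t = g ^ k • γ 0 := by
    intro k
    induction k with
    | zero => exact ⟨0, by simp⟩
    | succ k ih =>
      obtain ⟨t, ht⟩ := ih
      have : g • γ t ∈ Set.range γ := hinv ▸ Set.smul_mem_smul_set ⟨t, rfl⟩
      obtain ⟨t', ht'⟩ := this
      exact ⟨t', by rw [ht', ht, pow_succ', mul_smul]⟩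
  have hself : ∀ t, IsProj γ (γ t) t := fun t s => by rw [dist_self]; exact dist_nonneg
  set D := 2 * dist (ContractionSpace.incl (γ 0) : ContractionSpace X K) y + R with hD
  have hhat : ∀ k : ℕ, hatDist K (γ 0) (g ^ k • γ 0) ≤ D := by
    intro k
    have t := dist_triangle4 (ContractionSpace.incl (γ 0) : ContractionSpace X K) y (g ^ k • y)
      (g ^ k • ContractionSpace.incl (γ 0))
    rw [dist_smul, dist_comm y (.incl (γ 0))] at t
    have := hR (MulAction.mem_orbit_self y) (MulAction.mem_orbit y (g ^ k))
    rw [ContractionSpace.smul_incl] at t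
    unfold hatDist
    linarith
  set E := C * (M * (2 * D + 4)) + C with hE
  have hdist : ∀ k : ℕ, dist (γ 0) (g ^ k • γ 0) ≤ E := by
    intro k
    obtain ⟨t, ht⟩ := hpow k
    have e := hM _ _ _ _ (hself 0) (hself t)
    rw [ht] at e
    have u := h.upper 0 t
    rw [ht] at u
    have e' : |0 - t| ≤ M * (2 * D + 4) :=
      e.trans (mul_le_mul_of_nonneg_left (by linarith [hhat k]) hM0)
    have := mul_le_mul_of_nonneg_left e' (show 0 ≤ C by linarith [h.one_le])
    linarith
  obtain ⟨k, hk⟩ := exists_nat_gt (L * (E + 2 * dist x₀ (γ 0) + L))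
  have e := (hlox k 0).1
  simp only [zpow_natCast, zpow_zero, one_smul, Int.cast_natCast, Int.cast_zero, sub_zero,
    Nat.abs_cast] at e
  have t := dist_triangle4 (g ^ k • x₀) (g ^ k • γ 0) (γ 0) x₀
  rw [dist_smul, dist_comm (g ^ k • γ 0), dist_comm (γ 0) x₀] at t
  have e2 : (k : ℝ) / L ≤ E + 2 * dist x₀ (γ 0) + L := by linarith [hdist k]
  rw [div_le_iff₀ (by linarith)] at e2
  linarith

end AxisThin

end ContractionSpaces

theorem mainTheorem3 {G X : Type*} [Group G] [MetricSpace X] [MulAction G X]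
    [IsIsometricSMul G X] (hX : ContractionSpaces.IsGeodesicSpace X)
    (hG : ContractionSpaces.IsProperAction G X)
    (K : ℝ≥0 → ℝ≥0∞) (hK : ContractionSpaces.IsFullGauge K)
    (hK10 : ∀ r : ℝ≥0, 10 * (r : ℝ≥0∞) + 1 ≤ K r) :
    ContractionSpaces.IsNonUniformlyAcylindrical G (ContractionSpaces.ContractionSpace X K) ∧
      ((∃ g : G, ContractionSpaces.HasStronglyContractingAxis X g) →
        ContractionSpaces.HasUnboundedOrbits G (ContractionSpaces.ContractionSpace X K)) :=
  ⟨ContractionSpaces.isNonUniformlyAcylindrical_contractionSpace hX hK.1 hG,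
    fun ⟨_, hg⟩ => ContractionSpaces.hasUnboundedOrbits_contractionSpace hX hK hK10 hg⟩
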